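/- Let the alphabet be $\{0,1\}$. Fix a universal prefix machine $U$, i.e. a partial computable map $(p,x)\mapsto U(p,x)$ on pairs of binary strings whose domain is prefix-free in $p$ for each $x$, and which is additively optimal among such maps; let $K(y|x)=\min\{\ell(p):U(p,x)=y\}$ and $K(y)=K(y|\epsilon)$, natural numbers being identified with binary strings by the standard bijection. A semimeasure is a function $\nu:\{0,1\}^*\to[0,1]$ with $\nu(\epsilon)\le 1$ and $\nu(x0)+\nu(x1)\le\nu(x)$ for all $x$; it is a measure if equality holds throughout, and a measure is deterministic if it equals $1$ on all prefixes of some infinite sequence. A function $f\ge 0$ on strings is enumerable (co-enumerable) if the set of pairs $(x,q)$, $q\ge 0$ rational, with $f(x)>q$ (resp. $f(x)<q$) is recursively enumerable; a measure $\mu$ is computable if it is enumerable and co-enumerable and $\{x:\mu(x)=0\}$ is decidable. For an enumerable function $f$ let $K(f|x)$ be the minimum of $K(i|x)$ over the indices $i$ of $f$ (programs enumerating $\{(x,q):f(x)>q\}$) in a standard numbering, and $K(f)=K(f|\epsilon)$. Let $M(x)=\sum_\nu 2^{-K(\nu)}\nu(x)$, the sum being over all enumerable semimeasures $\nu$. For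 a measure $\mu$ and a string $x$ of length $l$ with $\mu(x)>0$ put $\mu(b|x)=\mu(xb)/\mu(x)$, $M(b|x)=M(xb)/M(x)$, $d_\mu(x)=\log_2\frac{M(x)}{\mu(x)}$, and $$D_{l+1:l+1}(x)=\sum_{b\in\{0,1\}}\mu(b|x)\ln\frac{\mu(b|x)}{M(b|x)}$$ (with $0\ln 0=0$). Then there are constants $C_0$ and $C_1$ such that for every $l\in\mathbb N$ there are a computable deterministic measure $\mu$ and a string $x\in\{0,1\}^l$ with $\mu(x)>0$ such that $$K(\mu|x)\le C_0,\qquad |d_\mu(x)|\le C_0,\qquad\text{and}\qquad D_{l+1:l+1}(x)\ \ge\ K(l)\ln 2-C_1 .$$ -/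

import Mathlib

namespace AlgPred

/-! ### Prefix machines and prefix complexity -/

/-- A prefix machine `T`: a partial computable function `(p, x) ↦ T(p, x)` of a binary program `p`
and a binary input `x` such that, for every input `x`, the set of programs on which `T` halts is
prefix free. -/
structure IsPrefixMachine (T : List Bool → List Bool →. List Bool) : Prop where
  partrec : Partrec₂ T
  prefixFree : ∀ x p q, (T p x).Dom → (T q x).Dom → p <+: q → p = q

/-- `condK T y x = min {ℓ(p) : T(p, x) = y}`, equal to `⊤` if there is no such program. -/
noncomputable def condK (T : List Bool → List Bool →. List Bool) (y x : List Bool) : ℕ∞ :=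
  ⨅ (p : List Bool) (_ : y ∈ T p x), (p.length : ℕ∞)

/-- A universal prefix machine: a prefix machine that is optimal up to an additive constant among
all prefix machines. -/
structure IsUniversalPrefixMachine (U : List Bool → List Bool →. List Bool) : Prop where
  isPrefixMachine : IsPrefixMachine U
  optimal : ∀ T, IsPrefixMachine T → ∃ c : ℕ, ∀ y x, condK U y x ≤ condK T y x + c

/-- The standard bijection from natural numbers to binary strings: the binary expansion of `n + 1`
without its leading digit `1`, here written with the least significant digit first. -/
def natStr (n : ℕ) : List Bool := (Nat.bits (n + 1)).dropLast

/-- The conditional prefix complexity `K(n | x)` of a natural number `n`. -/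
noncomputable def condKNat (U : List Bool → List Bool →. List Bool) (n : ℕ) (x : List Bool) : ℕ∞ :=
  condK U (natStr n) x

/-- The prefix complexity `K(n) = K(n | ε)` of a natural number `n`. -/
noncomputable def KNat (U : List Bool → List Bool →. List Bool) (n : ℕ) : ℕ∞ :=
  condKNat U n []

/-- The complexities with respect to a universal prefix machine are finite. -/
theorem IsUniversalPrefixMachine.condK_ne_top {U : List Bool → List Bool →. List Bool}
    (hU : IsUniversalPrefixMachine U) (y x : List Bool) : condK U y x ≠ ⊤ := by
  let T : List Bool → List Bool →. List Bool := fun p _ => bif p.isEmpty then Part.some y else Part.none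
  have hdom : ∀ p x, (T p x).Dom → p = [] := by
    intro p x h
    cases p with
    | nil => rfl
    | cons a p => simp [T] at h
  have hT : IsPrefixMachine T := by
    refine ⟨?_, fun x p q hp hq _ => by rw [hdom p x hp, hdom q x hq]⟩
    have hc : Computable (fun a : List Bool × List Bool => a.1.isEmpty) := by
      have h : Computable (fun a : List Bool × List Bool => a.1.length == 0) :=
        (Primrec.beq.comp (Primrec.list_length.comp Primrec.fst) (Primrec.const 0)).to_comp
      refine h.of_eq fun a => ?_
      cases a.1 <;> simp
    exact Partrec.cond hc (Computable.const y).partrec Partrec.none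
  obtain ⟨c, hc⟩ := hU.optimal T hT
  have h1 : condK T y x ≤ 0 :=
    iInf₂_le_of_le [] (show y ∈ T [] x by simp [T]) (by simp)
  have h2 : condK U y x ≤ (c : ℕ∞) := by
    refine (hc y x).trans ?_
    simpa using add_le_add_left h1 (c : ℕ∞)
  exact ne_top_of_le_ne_top (ENat.natCast_ne_top c) h2

/-! ### Semimeasures and their computability -/

/-- A semimeasure on binary strings: `ρ(x0) + ρ(x1) ≤ ρ(x)` and `ρ(ε) ≤ 1`, with `ρ ≥ 0`
(hence all values lie in `[0, 1]`). -/
structure IsSemimeasure (ρ : List Bool → ℝ) : Prop where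
  nonneg : ∀ x, 0 ≤ ρ x
  nil_le : ρ [] ≤ 1
  add_le : ∀ x, ρ (x ++ [false]) + ρ (x ++ [true]) ≤ ρ x

/-- A measure on binary strings: `ρ(x0) + ρ(x1) = ρ(x)` and `ρ(ε) = 1`, with `ρ ≥ 0`. -/
structure IsMeasure (ρ : List Bool → ℝ) : Prop where
  nonneg : ∀ x, 0 ≤ ρ x
  nil_eq : ρ [] = 1
  add_eq : ∀ x, ρ (x ++ [false]) + ρ (x ++ [true]) = ρ x

/-- A measure is deterministic if some infinite sequence `α` has `ρ(α_{1:n}) = 1` for all `n`. -/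
def IsDeterministic (ρ : List Bool → ℝ) : Prop :=
  ∃ α : ℕ → Bool, ∀ n, ρ (List.ofFn fun i : Fin n => α i) = 1

/-- A nonnegative function `f` is enumerable if `{(x, q) : f(x) > q}` is recursively enumerable,
where `q = k / (n + 1)` runs through the nonnegative rationals. -/
def IsEnumerable (f : List Bool → ℝ) : Prop :=
  REPred fun a : List Bool × ℕ × ℕ => (a.2.1 : ℝ) / (a.2.2 + 1) < f a.1

/-- A nonnegative function `f` is co-enumerable if `{(x, q) : f(x) < q}` is recursively enumerable,
where `q = k / (n + 1)` runs through the nonnegative rationals. -/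
def IsCoEnumerable (f : List Bool → ℝ) : Prop :=
  REPred fun a : List Bool × ℕ × ℕ => f a.1 < (a.2.1 : ℝ) / (a.2.2 + 1)

/-- A computable measure: a measure that is enumerable and co-enumerable and whose set of zeros is
decidable. -/
structure IsComputableMeasure (μ : List Bool → ℝ) : Prop where
  isMeasure : IsMeasure μ
  enumerable : IsEnumerable μ
  coEnumerable : IsCoEnumerable μ
  zeros : ComputablePred fun x => μ x = 0

/-! ### Complexity of functions and the universal prior -/

/-- `i` is an index of the enumerable nonnegative function `f`: the `i`-th partial recursive
function halts exactly on the (codes of the) elements of `{(x, q) : f(x) > q}`. -/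
def IsIndex (i : ℕ) (f : List Bool → ℝ) : Prop :=
  ∀ a : List Bool × ℕ × ℕ,
    ((Denumerable.ofNat Nat.Partrec.Code i).eval (Encodable.encode a)).Dom ↔
      (a.2.1 : ℝ) / (a.2.2 + 1) < f a.1

/-- The conditional prefix complexity `K(f | x)` of an enumerable function `f`: the least
complexity given `x` of an index of `f`. -/
noncomputable def condKFun (U : List Bool → List Bool →. List Bool) (f : List Bool → ℝ)
    (x : List Bool) : ℕ∞ :=
  ⨅ (i : ℕ) (_ : IsIndex i f), condKNat U i x

/-- `2 ^ (-k)`, with `2 ^ (-∞) = 0`. -/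
noncomputable def twoPowNeg (k : ℕ∞) : ℝ := if k = ⊤ then 0 else (2 : ℝ)⁻¹ ^ k.toNat

/-- The universal (Solomonoff-Levin) prior
`M(x) = ∑_ν 2 ^ (-K(ν)) ν(x)`, the sum being over all enumerable semimeasures `ν`. -/
noncomputable def prior (U : List Bool → List Bool →. List Bool) (x : List Bool) : ℝ :=
  ∑' ν : {ν : List Bool → ℝ // IsSemimeasure ν ∧ IsEnumerable ν},
    twoPowNeg (condKFun U ν.1 []) * ν.1 x

/-! ### Conditional probability, randomness deficiency, divergence -/

/-- The conditional probability `ρ(y | x) = ρ(xy) / ρ(x)`, used for `ρ(x) ≠ 0`. -/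
noncomputable def condProb (ρ : List Bool → ℝ) (y x : List Bool) : ℝ := ρ (x ++ y) / ρ x

/-- The randomness deficiency `d_μ(x) = log₂ (M(x) / μ(x))`, used for `μ(x) ≠ 0`. -/
noncomputable def deficiency (U : List Bool → List Bool →. List Bool) (μ : List Bool → ℝ)
    (x : List Bool) : ℝ :=
  Real.logb 2 (prior U x / μ x)

/-- The divergence `D_{l+1:l+m}(x) = E[ln (μ(ω_{l+1:l+m} | x) / M(ω_{l+1:l+m} | x)) | x]` of the
next `m` symbols after a string `x` of length `l` with `μ(x) ≠ 0`. -/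
noncomputable def divergence (U : List Bool → List Bool →. List Bool) (μ : List Bool → ℝ)
    (x : List Bool) (m : ℕ) : ℝ :=
  ∑ y : Fin m → Bool, condProb μ (List.ofFn y) x *
    Real.log (condProb μ (List.ofFn y) x / condProb (prior U) (List.ofFn y) x)

end AlgPred

namespace AlgPred

open scoped ENNReal

/-! ### Binary strings and natural numbers -/

/-! Take x = 0ˡ and let μ be the point mass on 0ˡ1^∞. Since l is the length of x, an index of μ is
computable from x, so K(μ|x) = O(1) (`exists_condKFun_le`). The point mass on 0^∞ is a term of M, so
M(0ˡ) lies between a positive constant and 1; as μ(x) = 1, the deficiency is bounded. Only the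
symbol 1 has positive μ-probability after x, hence D = ln M(0ˡ) - ln M(0ˡ1), and everything reduces
to M(0ˡ1) ≤ c·2^(-K(l)) (`ePrior_zerosOne_le`).

The strings 0ˡ1 are pairwise incomparable, so a semimeasure gives them total mass at most 1
(`IsSemimeasure.tsum_zerosOne_le`), and the bound should follow from the coding theorem: an
enumerable family of masses with sum at most 1 is dominated by 2^(-K(l)). The obstacle is that M
sums over semimeasures, whereas a program may output an index of no semimeasure, and this cannot be
decided. So M(0ˡ1) is majorized by an enumerable quantity. All events "the index output by p
certifies a value above 2^(-j) at 0ˡ1" are enumerated, each is given weight 2^(-ℓ(p)-j-1), and a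
program is cut off once its events exceed the budget Σ 2^(-j) ≤ 2. Semimeasures never exceed it.
Kraft's inequality bounds the total weight by 1 (`tsum_weight_budgeted`), and the weight attached to
l is at least M(0ˡ1)/4 (`le_tsum_weight_budgeted`).

The coding theorem itself (`coding_theorem`) rests on the Kraft-Chaitin construction
`exists_prefixMachine`: requests for code lengths are served in order of arrival by consecutive
subintervals of [0,1]. -/

theorem natStr_zero : natStr 0 = [] := by simp [natStr]

/-- Since m + 2 = 2(m/2 + 1) + m % 2, the string of m + 1 is one bit followed by the string of m/2.
This recursion gives both the inverse `strNat` and computability by course-of-values recursion. -/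
theorem natStr_succ (m : ℕ) : natStr (m + 1) = decide (m % 2 = 1) :: natStr (m / 2) := by
  have h : m + 1 + 1 = Nat.bit (decide (m % 2 = 1)) (m / 2 + 1) := by
    rw [Nat.bit_val]
    rcases Nat.mod_two_eq_zero_or_one m with h | h <;> simp [h] <;> omega
  unfold natStr
  rw [h, Nat.bits_append_bit _ _ (by simp)]
  have h2 : Nat.bits (m / 2 + 1) ≠ [] := by
    intro h0
    have := congrArg List.length h0
    rw [Nat.size_eq_bits_len] at this
    have h3 : 0 < (m / 2 + 1).size := Nat.size_pos.2 (Nat.succ_pos _)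
    simp only [List.length_nil] at this
    omega
  rw [List.dropLast_cons_of_ne_nil h2]

/-- The natural number whose `natStr` is the given string. -/
def strNat (s : List Bool) : ℕ := s.foldr (fun b a => 2 * a + 1 + b.toNat) 0

theorem strNat_natStr (n : ℕ) : strNat (natStr n) = n := by
  induction n using Nat.strong_induction_on with
  | _ n ih =>
    cases n with
    | zero => simp [natStr_zero, strNat]
    | succ m =>
      have := ih (m / 2) (by omega)
      rw [natStr_succ]
      simp only [strNat, List.foldr_cons] at this ⊢
      rw [this]
      rcases Nat.mod_two_eq_zero_or_one m with h | h <;> simp [h] <;> omega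

theorem primrec_toNat : Primrec Bool.toNat := Primrec.dom_finite _

theorem computable_strNat : Computable strNat := by
  have h : Primrec₂ fun (_ : List Bool) (q : Bool × ℕ) => 2 * q.2 + 1 + q.1.toNat := by
    refine Primrec.nat_add.comp (Primrec.succ.comp (Primrec.nat_mul.comp (Primrec.const 2) ?_)) ?_
    · exact Primrec.snd.comp Primrec.snd
    · exact primrec_toNat.comp (Primrec.fst.comp Primrec.snd)
  exact (Primrec.list_foldr Primrec.id (Primrec.const 0) h).to_comp

theorem computable_natStr : Computable natStr := by
  have hg : Primrec₂ fun (_ : Unit) (L : List (List Bool)) =>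
      if L.length = 0 then some [] else
        (L[(L.length - 1) / 2]?).map fun s => decide ((L.length - 1) % 2 = 1) :: s := by
    have hlen : Primrec fun a : Unit × List (List Bool) => a.2.length - 1 :=
      Primrec.nat_sub.comp (Primrec.list_length.comp Primrec.snd) (Primrec.const 1)
    refine Primrec.ite (Primrec.eq.comp (Primrec.list_length.comp Primrec.snd) (Primrec.const 0))
      (Primrec.const _) ?_
    refine Primrec.option_map (Primrec.list_getElem?.comp Primrec.snd
      (Primrec.nat_div.comp hlen (Primrec.const 2))) ?_
    refine Primrec.list_cons.comp (PrimrecPred.decide (Primrec.eq.comp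
      (Primrec.nat_mod.comp (hlen.comp Primrec.fst) (Primrec.const 2)) (Primrec.const 1)))
      Primrec.snd
  have := Primrec.nat_strong_rec (fun (_ : Unit) n => natStr n) hg (by
    intro _ n
    cases n with
    | zero => simp [natStr_zero]
    | succ m =>
      have : m / 2 < m + 1 := by omega
      simp [natStr_succ, this])
  exact (this.comp (Primrec.const ()) Primrec.id).to_comp

/-! ### Sums of powers of two along a stream of exponents -/

/-- `dyadicSum f N` is the integer `2 ^ N * ∑ 2 ^ (-d)`, the sum being over the exponents `d`
occurring among `f 0, …, f (N - 1)`, provided that `d ≤ n` whenever `f n = some d`. -/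
def dyadicSum (f : ℕ → Option ℕ) : ℕ → ℕ
  | 0 => 0
  | N + 1 => 2 * dyadicSum f N + (f N).elim 0 fun d => 2 ^ (N + 1 - d)

theorem computable_pow_two : Computable fun n : ℕ => 2 ^ n := by
  have h : Primrec fun n : ℕ => Nat.rec (motive := fun _ => ℕ) 1 (fun _ y => 2 * y) n :=
    Primrec.nat_rec₁ 1 (Primrec.nat_mul.comp (Primrec.const 2) Primrec.snd)
  refine h.to_comp.of_eq fun n => ?_
  induction n with
  | zero => rfl
  | succ n ih => simp only [pow_succ]; rw [← ih, mul_comm]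

theorem computable_dyadicSum {α : Type*} [Primcodable α] {f : α → ℕ → Option ℕ}
    (hf : Computable₂ f) : Computable₂ fun a N => dyadicSum (f a) N := by
  have hstep : Computable₂ fun (a : α × ℕ) (q : ℕ × ℕ) =>
      2 * q.2 + (f a.1 q.1).elim 0 fun d => 2 ^ (q.1 + 1 - d) := by
    refine Primrec.nat_add.to_comp.comp (Primrec.nat_mul.to_comp.comp (Computable.const 2)
      (Computable.snd.comp Computable.snd)) ?_
    have h1 : Computable fun b : (α × ℕ) × (ℕ × ℕ) => f b.1.1 b.2.1 :=
      hf.comp (Computable.fst.comp Computable.fst) (Computable.fst.comp Computable.snd)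
    have h2 : Computable₂ fun (b : (α × ℕ) × (ℕ × ℕ)) (d : ℕ) => 2 ^ (b.2.1 + 1 - d) :=
      computable_pow_two.comp (Primrec.nat_sub.to_comp.comp
        (Computable.succ.comp (Computable.fst.comp (Computable.snd.comp Computable.fst)))
        Computable.snd)
    refine (Computable.option_casesOn h1 (Computable.const 0) h2).of_eq fun b => ?_
    cases f b.1.1 b.2.1 <;> rfl
  refine (Computable.nat_rec (Computable.snd (α := α) (β := ℕ)) (Computable.const 0)
    hstep).of_eq fun a => ?_
  obtain ⟨a, N⟩ := a
  induction N with
  | zero => rfl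
  | succ N ih => simp only [dyadicSum] at ih ⊢; rw [← ih]

/-! ### Enumerations without repetitions -/

/-- Time n codes a pair (t, a), and a is emitted exactly when it is first accepted at stage t + 1;
this gives uniqueness. Acceptance also waits until d a ≤ t ≤ n, so that an exponent never exceeds
its time of appearance and the scaled partial sums remain integers. -/
theorem exists_enumeration {α : Type*} [Primcodable α] {R : α → Prop} (hR : REPred R)
    {d : α → ℕ} (hd : Computable d) :
    ∃ g : ℕ → Option α, Computable g ∧ (∀ n a, g n = some a → d a ≤ n) ∧
      (∀ n a, g n = some a → R a) ∧ (∀ a, R a → ∃! n, g n = some a) := by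
  classical
  obtain ⟨c, hc⟩ := Nat.Partrec.Code.exists_code.1 hR
  let st : ℕ → α → Bool := fun t a =>
    (Nat.Partrec.Code.evaln t c (Encodable.encode a)).isSome && decide (d a < t)
  have hst0 : ∀ a, st 0 a = false := fun a => by simp [st]
  have hmono : ∀ {s t a}, s ≤ t → st s a = true → st t a = true := by
    intro s t a h h1
    simp only [st, Bool.and_eq_true, decide_eq_true_eq, Option.isSome_iff_exists] at h1 ⊢
    obtain ⟨⟨x, hx⟩, h2⟩ := h1
    exact ⟨⟨x, Nat.Partrec.Code.evaln_mono h hx⟩, by omega⟩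
  have hdom : ∀ a, (Nat.Partrec.Code.eval c (Encodable.encode a)).Dom ↔ R a := by
    intro a
    rw [hc]
    simp [Part.assert]
  have hstR : ∀ {t a}, st t a = true → R a := by
    intro t a h
    simp only [st, Bool.and_eq_true, decide_eq_true_eq, Option.isSome_iff_exists] at h
    obtain ⟨⟨x, hx⟩, -⟩ := h
    exact (hdom a).1 (Part.dom_iff_mem.2 ⟨x, Nat.Partrec.Code.evaln_sound hx⟩)
  have hRst : ∀ a, R a → ∃ t, st t a = true := by
    intro a h
    obtain ⟨x, hx⟩ := Part.dom_iff_mem.1 ((hdom a).2 h)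
    obtain ⟨k, hk⟩ := Nat.Partrec.Code.evaln_complete.1 hx
    refine ⟨max k (d a + 1), ?_⟩
    simp only [st, Bool.and_eq_true, decide_eq_true_eq, Option.isSome_iff_exists]
    exact ⟨⟨x, Nat.Partrec.Code.evaln_mono (le_max_left _ _) hk⟩, by omega⟩
  let g : ℕ → Option α := fun n => (Encodable.decode (α := α) n.unpair.2).bind fun a =>
    bif (st (n.unpair.1 + 1) a && !(st n.unpair.1 a)) && (Encodable.encode a == n.unpair.2)
    then some a else none
  have hg : ∀ n a, g n = some a ↔ Encodable.encode a = n.unpair.2 ∧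
      st (n.unpair.1 + 1) a = true ∧ st n.unpair.1 a = false := by
    intro n a
    simp only [g, Option.bind_eq_some_iff]
    constructor
    · rintro ⟨b, hb, h⟩
      cases hh : (st (n.unpair.1 + 1) b && !(st n.unpair.1 b)) &&
          (Encodable.encode b == n.unpair.2) with
      | false => rw [hh] at h; simp at h
      | true =>
        rw [hh] at h
        simp only [cond_true, Option.some.injEq] at h
        subst h
        simp at hh
        exact ⟨hh.2, hh.1⟩
    · rintro ⟨h1, h2, h3⟩
      refine ⟨a, by rw [← h1, Encodable.encodek], ?_⟩
      simp [h1, h2, h3]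
  have hcst : Computable₂ st := by
    refine (Primrec.and.to_comp.comp (g := fun p : ℕ × α =>
      (Nat.Partrec.Code.evaln p.1 c (Encodable.encode p.2)).isSome) ?_ ?_)
    · exact (Primrec.option_isSome.comp (Nat.Partrec.Code.primrec_evaln.comp
        (Primrec.pair (Primrec.pair Primrec.fst (Primrec.const c))
          (Primrec.encode.comp Primrec.snd)))).to_comp
    · exact (PrimrecPred.decide (Primrec.nat_lt.comp Primrec.fst Primrec.snd)).to_comp.comp
        (Computable.pair (hd.comp Computable.snd) Computable.fst)
  refine ⟨g, ?_, ?_, ?_, ?_⟩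
  · refine Computable.option_bind (Computable.decode.comp
      (Computable.snd.comp Computable.unpair)) ?_
    have ht : Computable fun p : ℕ × α => p.1.unpair.1 :=
      Computable.fst.comp (Computable.unpair.comp Computable.fst)
    refine Computable.cond (Primrec.and.to_comp.comp (Primrec.and.to_comp.comp
      (hcst.comp (Computable.succ.comp ht) Computable.snd)
      (Primrec.not.to_comp.comp (hcst.comp ht Computable.snd)))
      (Primrec.beq.to_comp.comp (Computable.encode.comp Computable.snd)
        (Computable.snd.comp (Computable.unpair.comp Computable.fst))))
      (Computable.option_some.comp Computable.snd) (Computable.const none)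
  · intro n a h
    obtain ⟨-, h2, -⟩ := (hg n a).1 h
    simp only [st, Bool.and_eq_true, decide_eq_true_eq] at h2
    have := Nat.unpair_left_le n
    omega
  · intro n a h
    exact hstR ((hg n a).1 h).2.1
  · intro a h
    have hex := hRst a h
    obtain ⟨t, ht⟩ : ∃ t, Nat.find hex = t + 1 := by
      refine Nat.exists_eq_succ_of_ne_zero fun h0 => ?_
      have := Nat.find_spec hex
      rw [h0, hst0] at this
      simp at this
    refine ⟨Nat.pair t (Encodable.encode a), (hg _ _).2 ?_, ?_⟩
    · simp only [Nat.unpair_pair, true_and]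
      refine ⟨ht ▸ Nat.find_spec hex, ?_⟩
      simpa using Nat.find_min hex (m := t) (by omega)
    · intro n hn
      obtain ⟨h1, h2, h3⟩ := (hg n a).1 hn
      have h4 : n.unpair.1 = t := by
        by_contra hne
        rcases lt_or_gt_of_ne hne with h5 | h5
        · exact Nat.find_min hex (m := n.unpair.1 + 1) (by omega) h2
        · have := hmono (show t + 1 ≤ n.unpair.1 by omega) (ht ▸ Nat.find_spec hex)
          rw [h3] at this
          simp at this
      rw [← h4, h1, Nat.pair_unpair]

/-! ### Coding by dyadic intervals -/

/-- The number with binary expansion `s`, most significant digit first. -/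
def strVal (s : List Bool) : ℕ := s.foldl (fun a b => 2 * a + b.toNat) 0

theorem strVal_append (s t : List Bool) : strVal (s ++ t) = strVal s * 2 ^ t.length + strVal t := by
  have h : ∀ (t : List Bool) (a : ℕ),
      t.foldl (fun a b => 2 * a + b.toNat) a = a * 2 ^ t.length + strVal t := by
    intro t
    induction t with
    | nil => intro a; simp [strVal]
    | cons b t ih =>
      intro a
      simp only [strVal, List.foldl_cons, List.length_cons] at ih ⊢
      rw [ih, ih (2 * 0 + b.toNat)]
      ring
  rw [strVal, List.foldl_append, h]
  rfl

theorem strVal_concat (s : List Bool) (b : Bool) :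
    strVal (s ++ [b]) = 2 * strVal s + b.toNat := by
  simp [strVal]

theorem strVal_lt (s : List Bool) : strVal s < 2 ^ s.length := by
  induction s using List.reverseRecOn with
  | nil => simp [strVal]
  | append_singleton s b ih =>
    rw [strVal_concat, List.length_append, List.length_singleton, pow_succ]
    cases b <;> simp <;> omega

theorem exists_strVal_eq (k : ℕ) : ∀ v < 2 ^ k, ∃ s : List Bool, s.length = k ∧ strVal s = v := by
  induction k with
  | zero => intro v hv; exact ⟨[], rfl, by simp [strVal]; omega⟩
  | succ k ih =>
    intro v hv
    rw [pow_succ] at hv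
    obtain ⟨s, hs, hv'⟩ := ih (v / 2) (by omega)
    refine ⟨s ++ [decide (v % 2 = 1)], by simp [hs], ?_⟩
    rw [strVal_concat, hv']
    rcases Nat.mod_two_eq_zero_or_one v with h | h <;> simp [h] <;> omega

theorem computable_strVal : Computable strVal := by
  have h : Primrec₂ fun (_ : List Bool) (q : ℕ × Bool) => 2 * q.1 + q.2.toNat :=
    Primrec.nat_add.comp (Primrec.nat_mul.comp (Primrec.const 2)
      (Primrec.fst.comp Primrec.snd)) (primrec_toNat.comp (Primrec.snd.comp Primrec.snd))
  exact (Primrec.list_foldl Primrec.id (Primrec.const 0) h).to_comp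

theorem dyadicSum_div_mono (f : ℕ → Option ℕ) :
    Monotone fun n => (dyadicSum f n : ℝ) / 2 ^ n := by
  refine monotone_nat_of_le_succ fun n => ?_
  rw [div_le_div_iff₀ (by positivity) (by positivity), pow_succ]
  have : 2 * dyadicSum f n ≤ dyadicSum f (n + 1) := by simp [dyadicSum]
  have h2 : (2 : ℝ) * dyadicSum f n ≤ dyadicSum f (n + 1) := by exact_mod_cast this
  nlinarith [show (0 : ℝ) < 2 ^ n by positivity]

theorem dyadicSum_div_succ {f : ℕ → Option ℕ} {n d : ℕ} (h : f n = some d) (hd : d ≤ n) :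
    (dyadicSum f (n + 1) : ℝ) / 2 ^ (n + 1) = dyadicSum f n / 2 ^ n + 1 / 2 ^ d := by
  obtain ⟨k, rfl⟩ := Nat.exists_eq_add_of_le hd
  simp only [dyadicSum, h, Option.elim_some]
  rw [show d + k + 1 - d = k + 1 by omega]
  push_cast
  field_simp
  ring

/-- The string `p` denotes a dyadic interval of length `2 ^ (-d - 1)` inside the interval of length
`2 ^ (-d)` reserved for the `n`-th exponent `d` of the stream `f`. -/
def Fits (f : ℕ → Option ℕ) (p : List Bool) (n d : ℕ) : Prop :=
  p.length = d + 1 ∧ dyadicSum f n * 2 ^ p.length ≤ strVal p * 2 ^ n ∧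
    strVal p * 2 ^ n < dyadicSum f n * 2 ^ p.length + 2 ^ n

theorem Fits.bounds {f : ℕ → Option ℕ} {p : List Bool} {n d : ℕ} (h : Fits f p n d)
    (hf : f n = some d) (hd : d ≤ n) :
    (dyadicSum f n : ℝ) / 2 ^ n ≤ strVal p / 2 ^ p.length ∧
      ((strVal p : ℝ) + 1) / 2 ^ p.length ≤ dyadicSum f (n + 1) / 2 ^ (n + 1) := by
  obtain ⟨h1, h2, h3⟩ := h
  have h2' : (dyadicSum f n : ℝ) * 2 ^ p.length ≤ strVal p * 2 ^ n := by exact_mod_cast h2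
  have h3' : (strVal p : ℝ) * 2 ^ n < dyadicSum f n * 2 ^ p.length + 2 ^ n := by exact_mod_cast h3
  constructor
  · rw [div_le_div_iff₀ (by positivity) (by positivity)]
    exact h2'
  · rw [dyadicSum_div_succ hf hd]
    have : (dyadicSum f n : ℝ) / 2 ^ n + 1 / 2 ^ d =
        (dyadicSum f n * 2 ^ p.length + 2 * 2 ^ n) / (2 ^ p.length * 2 ^ n) := by
      rw [h1, pow_succ]; field_simp
    rw [this, div_le_div_iff₀ (by positivity) (by positivity)]
    nlinarith [show (0 : ℝ) < 2 ^ p.length by positivity]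

/-- A prefix relation means containment of dyadic intervals, while the intervals reserved for
different times are disjoint because the partial sums increase. -/
theorem Fits.eq_of_prefix {f : ℕ → Option ℕ} {p q : List Bool} {n m d e : ℕ} (hp : Fits f p n d)
    (hq : Fits f q m e) (hfn : f n = some d) (hd : d ≤ n) (hfm : f m = some e) (he : e ≤ m)
    (h : p <+: q) : n = m := by
  obtain ⟨r, rfl⟩ := h
  obtain ⟨p1, p2⟩ := hp.bounds hfn hd
  obtain ⟨q1, q2⟩ := hq.bounds hfm he
  have hv : (strVal (p ++ r) : ℝ) = strVal p * 2 ^ r.length + strVal r := by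
    exact_mod_cast strVal_append p r
  have hr : (strVal r : ℝ) + 1 ≤ 2 ^ r.length := by exact_mod_cast strVal_lt r
  have h1 : (strVal p : ℝ) / 2 ^ p.length ≤ strVal (p ++ r) / 2 ^ (p ++ r).length := by
    rw [hv, List.length_append, pow_add, div_le_div_iff₀ (by positivity) (by positivity)]
    nlinarith [show (0 : ℝ) ≤ strVal r * 2 ^ p.length by positivity]
  have h2 : ((strVal (p ++ r) : ℝ) + 1) / 2 ^ (p ++ r).length ≤ (strVal p + 1) / 2 ^ p.length := by
    rw [hv, List.length_append, pow_add, div_le_div_iff₀ (by positivity) (by positivity)]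
    nlinarith [show (0 : ℝ) < 2 ^ p.length by positivity]
  have h3 : (strVal (p ++ r) : ℝ) / 2 ^ (p ++ r).length <
      ((strVal (p ++ r) : ℝ) + 1) / 2 ^ (p ++ r).length := by
    gcongr; linarith
  rcases lt_trichotomy n m with hnm | hnm | hnm
  · have := dyadicSum_div_mono f (show n + 1 ≤ m from hnm)
    simp only at this
    linarith
  · exact hnm
  · have := dyadicSum_div_mono f (show m + 1 ≤ n from hnm)
    simp only at this
    linarith

theorem exists_fits {f : ℕ → Option ℕ} (hsum : ∀ N, dyadicSum f N ≤ 2 ^ N) {n d : ℕ}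
    (hf : f n = some d) (hd : d ≤ n) : ∃ p, Fits f p n d := by
  -- The ceiling of 2^(d+1)·S, where S is the partial sum before time n: the first grid point of
  -- mesh 2^(-d-1) not to the left of S. The dyadic interval starting there ends before S + 2^(-d).
  set v := (dyadicSum f n * 2 ^ (d + 1) + (2 ^ n - 1)) / 2 ^ n with hv
  have hpos : 0 < 2 ^ n := by positivity
  have h1 : v * 2 ^ n ≤ dyadicSum f n * 2 ^ (d + 1) + (2 ^ n - 1) := Nat.div_mul_le_self _ _
  have h2 : dyadicSum f n * 2 ^ (d + 1) ≤ v * 2 ^ n := by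
    have := Nat.lt_div_mul_add (a := dyadicSum f n * 2 ^ (d + 1) + (2 ^ n - 1)) hpos
    rw [← hv] at this
    omega
  -- The bound on the sum up to n + 1 says that the whole reserved interval lies in [0,1].
  have h3 : v < 2 ^ (d + 1) := by
    have h4 := hsum (n + 1)
    obtain ⟨k, rfl⟩ := Nat.exists_eq_add_of_le hd
    simp only [dyadicSum, hf, Option.elim_some] at h4
    rw [show d + k + 1 - d = k + 1 by omega] at h4
    have h5 : v * 2 ^ (d + k) < 2 ^ (d + 1) * 2 ^ (d + k) := by
      have h6 : (2 * dyadicSum f (d + k) + 2 ^ (k + 1)) * 2 ^ d ≤ 2 ^ (d + k + 1) * 2 ^ d :=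
        Nat.mul_le_mul_right _ h4
      have e1 : dyadicSum f (d + k) * 2 ^ (d + 1) = 2 * dyadicSum f (d + k) * 2 ^ d := by ring
      have e2 : 2 ^ (k + 1) * 2 ^ d = 2 * 2 ^ (d + k) := by ring
      have e3 : 2 ^ (d + k + 1) * 2 ^ d = 2 ^ (d + 1) * 2 ^ (d + k) := by ring
      rw [add_mul, e2, e3] at h6
      omega
    exact lt_of_mul_lt_mul_right h5 (Nat.zero_le _)
  obtain ⟨p, hp, hpv⟩ := exists_strVal_eq _ v h3
  refine ⟨p, hp, ?_, ?_⟩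
  · rw [hp, hpv]; exact h2
  · rw [hp, hpv]; omega

/-- Kraft-Chaitin: on input p the machine searches for the request whose reserved interval p fits.
The extra bit in the code length pays for aligning that interval with the dyadic grid. -/
theorem exists_prefixMachine {g : ℕ → Option (ℕ × ℕ)} (hg : Computable g)
    (hle : ∀ n a, g n = some a → a.2 ≤ n)
    (hsum : ∀ N, dyadicSum (fun n => (g n).map Prod.snd) N ≤ 2 ^ N) :
    ∃ T, IsPrefixMachine T ∧ ∀ n a, g n = some a → ∀ x,
      condK T (natStr a.1) x ≤ (a.2 + 1 : ℕ) := by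
  classical
  set f : ℕ → Option ℕ := fun n => (g n).map Prod.snd with hf
  have hfg : ∀ {n a}, g n = some a → f n = some a.2 := fun h => by simp [hf, h]
  let out : List Bool → ℕ → Option (List Bool) := fun p n => (g n).bind fun a =>
    bif (p.length == a.2 + 1) && (decide (dyadicSum f n * 2 ^ p.length ≤ strVal p * 2 ^ n) &&
      decide (strVal p * 2 ^ n < dyadicSum f n * 2 ^ p.length + 2 ^ n))
    then some (natStr a.1) else none
  have hout : ∀ p n s, out p n = some s ↔ ∃ a, g n = some a ∧ Fits f p n a.2 ∧ natStr a.1 = s := by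
    intro p n s
    simp only [out, Option.bind_eq_some_iff, Fits]
    refine exists_congr fun a => and_congr_right fun _ => ?_
    cases hc : (p.length == a.2 + 1) && (decide (dyadicSum f n * 2 ^ p.length ≤ strVal p * 2 ^ n) &&
      decide (strVal p * 2 ^ n < dyadicSum f n * 2 ^ p.length + 2 ^ n)) with
    | false =>
      simp only [cond_false, reduceCtorEq, false_iff]
      rintro ⟨⟨h1, h2, h3⟩, -⟩
      rw [decide_eq_true h2, decide_eq_true h3, h1] at hc
      simp at hc
    | true =>
      simp only [Bool.and_eq_true, beq_iff_eq, decide_eq_true_eq] at hc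
      simp only [cond_true, Option.some.injEq]
      exact ⟨fun h => ⟨hc, h⟩, fun h => h.2⟩
  -- Used twice: for prefix-freeness, and with p = q to see that the output does not depend on which
  -- time the search finds.
  have huniq : ∀ {p q n m s t}, out p n = some s → out q m = some t → p <+: q → p = q ∧ s = t := by
    intro p q n m s t h1 h2 hpq
    obtain ⟨a, ha, fa, rfl⟩ := (hout _ _ _).1 h1
    obtain ⟨b, hb, fb, rfl⟩ := (hout _ _ _).1 h2
    have hnm := fa.eq_of_prefix fb (hfg ha) (hle _ _ ha) (hfg hb) (hle _ _ hb) hpq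
    subst hnm
    obtain rfl : a = b := by rw [ha] at hb; exact Option.some.inj hb
    exact ⟨hpq.eq_of_length (fa.1.trans fb.1.symm), rfl⟩
  have hcomp : Computable₂ out := by
    refine Computable.option_bind (hg.comp Computable.snd) ?_
    have hlen : Computable fun b : (List Bool × ℕ) × (ℕ × ℕ) => b.1.1.length :=
      Computable.list_length.comp (Computable.fst.comp Computable.fst)
    have hn : Computable fun b : (List Bool × ℕ) × (ℕ × ℕ) => b.1.2 :=
      Computable.snd.comp Computable.fst
    have hpn := computable_pow_two.comp hn
    have hff : Computable f :=
      Computable.option_map hg (Computable.snd.comp Computable.snd)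
    have hD : Computable (dyadicSum f) :=
      (computable_dyadicSum (f := fun (_ : Unit) n => f n) (hff.comp Computable.snd)).comp
        (Computable.const ()) Computable.id
    generalize dyadicSum f = D at hD
    have hDl : Computable fun b : (List Bool × ℕ) × (ℕ × ℕ) => D b.1.2 * 2 ^ b.1.1.length :=
      Primrec.nat_mul.to_comp.comp (hD.comp hn) (computable_pow_two.comp hlen)
    have hv : Computable fun b : (List Bool × ℕ) × (ℕ × ℕ) => strVal b.1.1 * 2 ^ b.1.2 :=
      Primrec.nat_mul.to_comp.comp (computable_strVal.comp
        (Computable.fst.comp Computable.fst)) hpn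
    have hle : Computable₂ fun a b : ℕ => decide (a ≤ b) :=
      (PrimrecPred.decide Primrec.nat_le).to_comp
    have hlt : Computable₂ fun a b : ℕ => decide (a < b) :=
      (PrimrecPred.decide Primrec.nat_lt).to_comp
    have h1 : Computable fun b : (List Bool × ℕ) × (ℕ × ℕ) => b.1.1.length == b.2.2 + 1 :=
      Primrec.beq.to_comp.comp hlen (Computable.succ.comp (Computable.snd.comp Computable.snd))
    have h2 := hle.comp hDl hv
    have h3 := hlt.comp hv (Primrec.nat_add.to_comp.comp hDl hpn)
    exact Computable.cond (Primrec.and.to_comp.comp h1 (Primrec.and.to_comp.comp h2 h3))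
      (Computable.option_some.comp (computable_natStr.comp (Computable.fst.comp Computable.snd)))
      (Computable.const none)
  refine ⟨fun p _ => Nat.rfindOpt (out p), ⟨?_, ?_⟩, ?_⟩
  · exact Partrec.rfindOpt (f := fun (b : List Bool × List Bool) n => out b.1 n)
      (hcomp.comp (Computable.fst.comp Computable.fst) Computable.snd)
  · intro x p q hp hq hpq
    obtain ⟨n, s, h1⟩ := Nat.rfindOpt_dom.1 hp
    obtain ⟨m, t, h2⟩ := Nat.rfindOpt_dom.1 hq
    exact (huniq h1 h2 hpq).1
  · intro n a ha x
    obtain ⟨p, hp⟩ := exists_fits hsum (hfg ha) (hle _ _ ha)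
    have h1 : out p n = some (natStr a.1) := (hout _ _ _).2 ⟨a, ha, hp, rfl⟩
    have h2 : natStr a.1 ∈ Nat.rfindOpt (out p) := by
      have hd : (Nat.rfindOpt (out p)).Dom := Nat.rfindOpt_dom.2 ⟨n, _, h1⟩
      obtain ⟨m, hm⟩ := Nat.rfindOpt_spec (Part.get_mem hd)
      rw [(huniq h1 hm (List.prefix_refl p)).2]
      exact Part.get_mem hd
    refine iInf₂_le_of_le p h2 ?_
    rw [hp.1]

/-! ### The coding theorem -/

theorem two_inv_pow_mul (d : ℕ) : (2 : ℝ≥0∞) ^ d * 2⁻¹ ^ d = 1 := by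
  rw [← mul_pow, ENNReal.mul_inv_cancel (by simp) (by simp), one_pow]

/-- The weight `2 ^ (-d)` of an exponent `d`, and `0` if there is none. -/
noncomputable def weight (o : Option ℕ) : ℝ≥0∞ := o.elim 0 fun d => 2⁻¹ ^ d

theorem natCast_dyadicSum {f : ℕ → Option ℕ} (hf : ∀ n d, f n = some d → d ≤ n) (N : ℕ) :
    (dyadicSum f N : ℝ≥0∞) = 2 ^ N * ∑ n ∈ Finset.range N, weight (f n) := by
  induction N with
  | zero => simp [dyadicSum]
  | succ N ih =>
    rw [Finset.sum_range_succ, dyadicSum]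
    push_cast
    rw [ih, mul_add, pow_succ]
    congr 1
    · ring
    · cases h : f N with
      | none => simp [weight]
      | some d =>
        obtain ⟨k, hk⟩ := Nat.exists_eq_add_of_le (hf N d h)
        simp only [weight, Option.elim_some]
        rw [show N + 1 - d = k + 1 by omega, hk, pow_add 2 d k]
        push_cast
        rw [show (2 : ℝ≥0∞) ^ d * 2 ^ k * 2 * 2⁻¹ ^ d = (2 ^ d * 2⁻¹ ^ d) * 2 ^ (k + 1) by ring,
          two_inv_pow_mul, one_mul]

theorem dyadicSum_le {f : ℕ → Option ℕ} (hf : ∀ n d, f n = some d → d ≤ n) {N B : ℕ}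
    (h : ∑ n ∈ Finset.range N, weight (f n) ≤ B) : dyadicSum f N ≤ B * 2 ^ N := by
  have : (dyadicSum f N : ℝ≥0∞) ≤ (B * 2 ^ N : ℕ) := by
    rw [natCast_dyadicSum hf, Nat.cast_mul, mul_comm]
    push_cast
    gcongr
  exact_mod_cast this

theorem sum_weight_le {f : ℕ → Option ℕ} (hf : ∀ n d, f n = some d → d ≤ n) {N B : ℕ}
    (h : dyadicSum f N ≤ B * 2 ^ N) : ∑ n ∈ Finset.range N, weight (f n) ≤ B := by
  have h1 : (dyadicSum f N : ℝ≥0∞) ≤ (B * 2 ^ N : ℕ) := by exact_mod_cast h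
  rw [natCast_dyadicSum hf, Nat.cast_mul, mul_comm (B : ℝ≥0∞)] at h1
  push_cast at h1
  exact (ENNReal.mul_le_mul_iff_right (by simp) (by simp)).1 h1

/-- Turns a comparison of real sums into a decidable comparison of integers. -/
theorem le_sum_weight_iff {f : ℕ → Option ℕ} (hf : ∀ n d, f n = some d → d ≤ n) (N j : ℕ) :
    2 ^ N ≤ 2 ^ j * dyadicSum f N ↔ 2⁻¹ ^ j ≤ ∑ n ∈ Finset.range N, weight (f n) := by
  have h1 : 2 ^ N ≤ 2 ^ j * dyadicSum f N ↔
      ((2 ^ N : ℕ) : ℝ≥0∞) ≤ ((2 ^ j * dyadicSum f N : ℕ) : ℝ≥0∞) := Nat.cast_le.symm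
  rw [h1, Nat.cast_mul, natCast_dyadicSum hf]
  push_cast
  rw [show (2 : ℝ≥0∞) ^ j * (2 ^ N * ∑ n ∈ Finset.range N, weight (f n)) =
      2 ^ N * (2 ^ j * ∑ n ∈ Finset.range N, weight (f n)) by ring]
  nth_rewrite 1 [← mul_one ((2 : ℝ≥0∞) ^ N)]
  rw [ENNReal.mul_le_mul_iff_right (by simp) (by simp), ← two_inv_pow_mul j,
    ENNReal.mul_le_mul_iff_right (by simp) (by simp)]

theorem tsum_enumeration {α : Type*} {g : ℕ → Option α} {R : α → Prop} [DecidablePred R]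
    (h1 : ∀ n a, g n = some a → R a) (h2 : ∀ a, R a → ∃! n, g n = some a) (F : α → ℝ≥0∞) :
    ∑' n, (g n).elim 0 F = ∑' a, if R a then F a else 0 := by
  classical
  have h : ∀ n, (g n).elim 0 F = ∑' a, if g n = some a then F a else 0 := by
    intro n
    cases hn : g n with
    | none => simp
    | some a =>
      simp only [Option.elim_some, Option.some.injEq]
      rw [tsum_eq_single a (fun b hb => if_neg fun h => hb h.symm), if_pos rfl]
  simp_rw [h]
  rw [ENNReal.tsum_comm]
  refine tsum_congr fun a => ?_
  by_cases ha : R a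
  · obtain ⟨n, hn, hu⟩ := h2 a ha
    rw [if_pos ha, tsum_eq_single n (fun m hm => if_neg fun h => hm (hu m h)), if_pos hn]
  · rw [if_neg ha]
    exact ENNReal.tsum_eq_zero.2 fun n => if_neg fun h => ha (h1 n a h)

/-- If k is the least exponent satisfying P, the sum is at most the geometric tail 2·2^(-k). -/
theorem tsum_pow_le (P : ℕ → Prop) [DecidablePred P] (x : ℝ≥0∞) (h : ∀ j, P j → 2⁻¹ ^ j ≤ x) :
    ∑' j, (if P j then (2⁻¹ : ℝ≥0∞) ^ j else 0) ≤ 2 * x := by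
  by_cases hex : ∃ j, P j
  · set k := Nat.find hex
    have h1 : ∑' j, (if P j then (2⁻¹ : ℝ≥0∞) ^ j else 0) ≤
        ∑' j, if k ≤ j then (2⁻¹ : ℝ≥0∞) ^ j else 0 := by
      refine ENNReal.tsum_le_tsum fun j => ?_
      split_ifs with hj hk
      · exact le_rfl
      · exact absurd (Nat.find_min' hex hj) hk
      · exact zero_le
      · exact le_rfl
    refine h1.trans ?_
    rw [← (add_left_injective k).tsum_eq]
    · simp only [le_add_iff_nonneg_left, zero_le, if_true, pow_add]
      rw [ENNReal.tsum_mul_right, ENNReal.tsum_geometric, ENNReal.one_sub_inv_two, inv_inv]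
      gcongr
      exact h k (Nat.find_spec hex)
    · intro j hj
      simp only [Function.mem_support, ne_eq, ite_eq_right_iff, Classical.not_imp] at hj
      exact ⟨j - k, by simp; omega⟩
  · push Not at hex
    simp [hex]

theorem exists_pow_lt {x : ℝ≥0∞} (h0 : x ≠ 0) (h1 : x ≤ 1) :
    ∃ j : ℕ, 2⁻¹ ^ j < x ∧ x ≤ 2 * 2⁻¹ ^ j := by
  have hex : ∃ j : ℕ, (2⁻¹ : ℝ≥0∞) ^ j < x :=
    ((ENNReal.tendsto_pow_atTop_nhds_zero_of_lt_one (by simp)).eventually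
      (gt_mem_nhds (pos_iff_ne_zero.2 h0))).exists
  refine ⟨Nat.find hex, Nat.find_spec hex, ?_⟩
  cases hj : Nat.find hex with
  | zero => exact h1.trans (by simp)
  | succ k =>
    have := Nat.find_min hex (m := k) (by omega)
    rw [pow_succ, mul_comm (2⁻¹ ^ k), ← mul_assoc, ENNReal.mul_inv_cancel (by simp) (by simp),
      one_mul]
    exact not_lt.1 this

/-- The exponents of `g` that are attached to `l`. -/
def restrict (g : ℕ → Option (ℕ × ℕ)) (l n : ℕ) : Option ℕ :=
  (g n).bind fun a => bif a.1 == l then some a.2 else none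

theorem weight_restrict (g : ℕ → Option (ℕ × ℕ)) (l n : ℕ) :
    weight (restrict g l n) = (g n).elim 0 fun a => if a.1 = l then 2⁻¹ ^ a.2 else 0 := by
  cases h : g n with
  | none => simp [restrict, weight, h]
  | some a =>
    by_cases hl : a.1 = l
    · simp [restrict, weight, h, hl]
    · simp [restrict, weight, h, hl, beq_false_of_ne hl]

theorem tsum_weight_restrict (g : ℕ → Option (ℕ × ℕ)) :
    ∑' l, ∑' n, weight (restrict g l n) = ∑' n, weight ((g n).map Prod.snd) := by
  rw [ENNReal.tsum_comm]
  refine tsum_congr fun n => ?_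
  simp only [weight_restrict]
  cases h : g n with
  | none => simp [weight]
  | some a =>
    simp only [Option.elim_some, weight, Option.map_some]
    rw [tsum_eq_single a.1 (fun b hb => if_neg fun h => hb h.symm), if_pos rfl]

/-- Write m(l) for the weight attached to l. The pairs (l, j) with 2^(-j) below a partial sum of
m(l) are enumerable and become the requests of a prefix machine; the smallest code obtained for l
has length -log₂ m(l) up to a constant. -/
theorem coding_theorem {U : List Bool → List Bool →. List Bool} (hU : IsUniversalPrefixMachine U)
    {g : ℕ → Option (ℕ × ℕ)} (hg : Computable g) (hle : ∀ n a, g n = some a → a.2 ≤ n)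
    (hsum : ∑' n, weight ((g n).map Prod.snd) ≤ 1) :
    ∃ c : ℕ, ∀ l, ∑' n, weight (restrict g l n) ≤ 2 ^ c * 2⁻¹ ^ (KNat U l).toNat := by
  classical
  have hr : ∀ l n d, restrict g l n = some d → d ≤ n := by
    intro l n d h
    simp only [restrict, Option.bind_eq_some_iff] at h
    obtain ⟨a, ha, h⟩ := h
    cases hc : a.1 == l with
    | false => simp [hc] at h
    | true => simp [hc] at h; exact h ▸ hle n a ha
  have hrc : Computable₂ (restrict g) := by
    refine Computable.option_bind (hg.comp Computable.snd) ?_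
    exact Computable.cond (Primrec.beq.to_comp.comp (Computable.fst.comp Computable.snd)
      (Computable.fst.comp Computable.fst))
      (Computable.option_some.comp (Computable.snd.comp Computable.snd)) (Computable.const none)
  let R : ℕ × ℕ → Prop := fun a => ∃ N, 2 ^ N ≤ 2 ^ a.2 * dyadicSum (restrict g a.1) N
  have hR : REPred R := by
    have hD := computable_dyadicSum hrc
    generalize hE : (fun l N => dyadicSum (restrict g l) N) = E at hD
    have hb : Computable₂ fun (a : ℕ × ℕ) N => decide (2 ^ N ≤ 2 ^ a.2 * E a.1 N) := by
      have hle : Computable₂ fun a b : ℕ => decide (a ≤ b) :=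
        (PrimrecPred.decide Primrec.nat_le).to_comp
      refine hle.comp (computable_pow_two.comp Computable.snd)
        (Primrec.nat_mul.to_comp.comp (computable_pow_two.comp
          (Computable.snd.comp Computable.fst))
          (hD.comp (Computable.fst.comp Computable.fst) Computable.snd))
    refine (Partrec.rfindOpt (f := fun (a : ℕ × ℕ) N =>
      bif decide (2 ^ N ≤ 2 ^ a.2 * E a.1 N) then some () else none)
      (Computable.cond hb (Computable.const _) (Computable.const _))).dom_re.of_eq fun a => ?_
    rw [Nat.rfindOpt_dom]
    subst hE
    simp [R, Bool.cond_eq_ite]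
  have hRiff : ∀ l j, R (l, j) ↔ ∃ N, 2⁻¹ ^ j ≤ ∑ n ∈ Finset.range N, weight (restrict g l n) :=
    fun l j => exists_congr fun N => le_sum_weight_iff (hr l) N j
  obtain ⟨e, hec, hed, heR, heu⟩ := exists_enumeration hR
    (d := fun a => a.2 + 1) (Computable.succ.comp Computable.snd)
  -- Requesting j + 1 instead of j absorbs the factor 2 lost in summing over all admissible j.
  let e' : ℕ → Option (ℕ × ℕ) := fun n => (e n).map fun a => (a.1, a.2 + 1)
  have hec' : Computable e' := Computable.option_map hec
    ((Computable.fst.comp Computable.snd).pair (Computable.succ.comp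
      (Computable.snd.comp Computable.snd)))
  have hle' : ∀ n a, e' n = some a → a.2 ≤ n := by
    intro n a h
    simp only [e', Option.map_eq_some_iff] at h
    obtain ⟨b, hb, rfl⟩ := h
    exact hed n b hb
  have hsum' : ∑' n, weight ((e' n).map Prod.snd) ≤ 1 := by
    have h1 : ∀ n, weight ((e' n).map Prod.snd) = (e n).elim 0 fun a => 2⁻¹ ^ (a.2 + 1) := by
      intro n
      cases h : e n <;> simp [e', weight, h]
    simp_rw [h1]
    rw [tsum_enumeration heR heu, ENNReal.tsum_prod']
    refine le_trans (ENNReal.tsum_le_tsum fun l => ?_) ((tsum_weight_restrict g).trans_le hsum)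
    have h2 : ∀ j, (if R (l, j) then (2⁻¹ : ℝ≥0∞) ^ (j + 1) else 0) =
        2⁻¹ * if R (l, j) then (2⁻¹ : ℝ≥0∞) ^ j else 0 := by
      intro j; split_ifs <;> simp [pow_succ, mul_comm]
    simp_rw [h2]
    rw [ENNReal.tsum_mul_left]
    calc _ ≤ 2⁻¹ * (2 * ∑' n, weight (restrict g l n)) := by
            gcongr
            refine tsum_pow_le _ _ fun j hj => ?_
            obtain ⟨N, hN⟩ := (hRiff l j).1 hj
            exact hN.trans (ENNReal.sum_le_tsum _)
      _ = _ := by rw [← mul_assoc, ENNReal.inv_mul_cancel (by simp) (by simp), one_mul]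
  obtain ⟨T, hT, hTK⟩ := exists_prefixMachine hec' hle' fun N => by
    have := dyadicSum_le (f := fun n => (e' n).map Prod.snd) (B := 1) (N := N) (by
      intro n d h
      obtain ⟨a, ha, rfl⟩ := Option.map_eq_some_iff.1 h
      exact hle' n a ha) (by simpa using (ENNReal.sum_le_tsum _).trans hsum')
    simpa using this
  obtain ⟨c, hc⟩ := hU.optimal T hT
  refine ⟨c + 3, fun l => ?_⟩
  rcases eq_or_ne (∑' n, weight (restrict g l n)) 0 with h0 | h0
  · rw [h0]; exact zero_le
  have hm1 : ∑' n, weight (restrict g l n) ≤ 1 :=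
    (ENNReal.le_tsum l).trans ((tsum_weight_restrict g).trans_le hsum)
  obtain ⟨j, hj, hj'⟩ := exists_pow_lt h0 hm1
  have hRj : R (l, j) := by
    rw [ENNReal.tsum_eq_iSup_nat] at hj
    obtain ⟨N, hN⟩ := lt_iSup_iff.1 hj
    exact (hRiff l j).2 ⟨N, hN.le⟩
  obtain ⟨n, hn, -⟩ := heu _ hRj
  -- One unit comes from the shifted request, one from the dyadic alignment, and c from passing to
  -- U.
  have hK : KNat U l ≤ (j + 2 + c : ℕ) := by
    refine (hc (natStr l) []).trans ?_
    have := hTK n (l, j + 1) (by simp [e', hn]) []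
    push_cast at this ⊢
    refine (add_le_add_left this _).trans (le_of_eq ?_)
    ring_nf
  have hK' : (KNat U l).toNat ≤ j + 2 + c := ENat.toNat_le_of_le_natCast hK
  calc _ ≤ 2 * 2⁻¹ ^ j := hj'
    _ = 2 ^ (c + 3) * 2⁻¹ ^ (j + 2 + c) := by
        rw [show j + 2 + c = (c + 2) + j by ring, pow_add 2⁻¹ (c + 2), pow_succ 2 (c + 2),
          show (2 : ℝ≥0∞) ^ (c + 2) * 2 * (2⁻¹ ^ (c + 2) * 2⁻¹ ^ j) =
            (2 ^ (c + 2) * 2⁻¹ ^ (c + 2)) * (2 * 2⁻¹ ^ j) by ring, two_inv_pow_mul, one_mul]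
    _ ≤ _ := by
        gcongr 2 ^ (c + 3) * ?_
        exact pow_le_pow_right_of_le_one' (by simp) hK'

/-! ### Kraft's inequality for prefix machines -/

theorem uniquelyDecodable_of_prefixFree {α : Type*} {S : Set (List α)} (hnil : [] ∉ S)
    (h : ∀ p ∈ S, ∀ q ∈ S, p <+: q → p = q) : InformationTheory.UniquelyDecodable S := by
  intro L₁
  induction L₁ with
  | nil =>
    intro L₂ _ h2 he
    cases L₂ with
    | nil => rfl
    | cons q L =>
      have : q = [] := by
        have := congrArg List.length he
        simp at this
        exact List.length_eq_zero_iff.1 (by omega)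
      exact absurd (this ▸ h2 q (by simp)) hnil
  | cons p L ih =>
    intro L₂ h1 h2 he
    cases L₂ with
    | nil =>
      have : p = [] := by
        simp only [List.flatten_cons, List.flatten_nil, List.append_eq_nil_iff] at he
        exact he.1
      exact absurd (this ▸ h1 p (by simp)) hnil
    | cons q L' =>
      simp only [List.flatten_cons] at he
      have hpq : p = q := by
        have e1 : p <+: p ++ L.flatten := List.prefix_append _ _
        have e2 : q <+: p ++ L.flatten := he ▸ List.prefix_append _ _
        rcases List.prefix_or_prefix_of_prefix e1 e2 with h3 | h3
        · exact h p (h1 p (by simp)) q (h2 q (by simp)) h3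
        · exact (h q (h2 q (by simp)) p (h1 p (by simp)) h3).symm
      subst hpq
      rw [ih L' (fun w hw => h1 w (by simp [hw])) (fun w hw => h2 w (by simp [hw]))
        (List.append_cancel_left he)]

/-- Reduces to the Kraft-McMillan inequality. The empty word is treated apart, since it destroys
unique decodability; a prefix-free set containing it has no other element. -/
theorem kraft_of_prefixFree {S : Finset (List Bool)} (h : ∀ p ∈ S, ∀ q ∈ S, p <+: q → p = q) :
    ∑ p ∈ S, (2⁻¹ : ℝ≥0∞) ^ p.length ≤ 1 := by
  by_cases hnil : [] ∈ S
  · have : S = {[]} := by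
      refine Finset.eq_singleton_iff_unique_mem.2 ⟨hnil, fun q hq => ?_⟩
      exact (h [] hnil q hq List.nil_prefix).symm
    simp [this]
  · have h1 := InformationTheory.kraft_mcmillan_inequality
      (uniquelyDecodable_of_prefixFree (S := (S : Set (List Bool))) (by simpa using hnil)
        (by simpa using h))
    simp only [Fintype.card_bool, Nat.cast_ofNat] at h1
    have h2 : ∑ p ∈ S, (2⁻¹ : ℝ≥0∞) ^ p.length =
        ENNReal.ofReal (∑ p ∈ S, (1 / 2 : ℝ) ^ p.length) := by
      rw [ENNReal.ofReal_sum_of_nonneg (fun _ _ => by positivity)]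
      refine Finset.sum_congr rfl fun p _ => ?_
      rw [ENNReal.ofReal_pow (by norm_num), one_div, ENNReal.ofReal_inv_of_pos (by norm_num)]
      simp
    rw [h2]
    exact ENNReal.ofReal_le_one.2 h1

theorem IsPrefixMachine.kraft {U : List Bool → List Bool →. List Bool} (hU : IsPrefixMachine U)
    (x : List Bool) [DecidablePred fun p => (U p x).Dom] :
    ∑' p, (if (U p x).Dom then (2⁻¹ : ℝ≥0∞) ^ p.length else 0) ≤ 1 := by
  rw [ENNReal.tsum_eq_iSup_sum]
  refine iSup_le fun s => ?_
  rw [← Finset.sum_filter]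
  refine kraft_of_prefixFree fun p hp q hq => ?_
  exact hU.prefixFree x p q (Finset.mem_filter.1 hp).2 (Finset.mem_filter.1 hq).2

/-! ### The universal prior with values in the extended nonnegative reals -/

/-- Enumerable semimeasures. -/
abbrev EnumSemimeasure : Type := {ν : List Bool → ℝ // IsSemimeasure ν ∧ IsEnumerable ν}

/-- `2 ^ (-K(f))`. -/
noncomputable def funWeight (U : List Bool → List Bool →. List Bool) (f : List Bool → ℝ) : ℝ≥0∞ :=
  2⁻¹ ^ (condKFun U f []).toNat

/-- The universal prior as an extended nonnegative real. -/
noncomputable def ePrior (U : List Bool → List Bool →. List Bool) (x : List Bool) : ℝ≥0∞ :=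
  ∑' ν : EnumSemimeasure, funWeight U ν.1 * ENNReal.ofReal (ν.1 x)

theorem IsEnumerable.exists_index {f : List Bool → ℝ} (hf : IsEnumerable f) : ∃ i, IsIndex i f := by
  obtain ⟨c, hc⟩ := Nat.Partrec.Code.exists_code.1 hf
  refine ⟨Encodable.encode c, fun a => ?_⟩
  rw [Denumerable.ofNat_encode, hc]
  simp [Part.assert]

theorem exists_of_condK_ne_top {U : List Bool → List Bool →. List Bool} {y x : List Bool}
    (h : condK U y x ≠ ⊤) : ∃ p, y ∈ U p x ∧ (p.length : ℕ∞) = condK U y x := by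
  obtain ⟨p, hp⟩ := ciInf_mem fun p => ⨅ (_ : y ∈ U p x), (p.length : ℕ∞)
  have hp' : (⨅ (_ : y ∈ U p x), (p.length : ℕ∞)) = condK U y x := hp
  by_cases hy : y ∈ U p x
  · exact ⟨p, hy, by rw [← hp']; simp [hy]⟩
  · rw [← hp'] at h; simp [hy] at h

theorem exists_of_condKFun_ne_top {U : List Bool → List Bool →. List Bool} {f : List Bool → ℝ}
    {x : List Bool} (h : condKFun U f x ≠ ⊤) :
    ∃ i, IsIndex i f ∧ condKNat U i x = condKFun U f x := by
  obtain ⟨i, hi⟩ := ciInf_mem fun i => ⨅ (_ : IsIndex i f), condKNat U i x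
  have hi' : (⨅ (_ : IsIndex i f), condKNat U i x) = condKFun U f x := hi
  by_cases hy : IsIndex i f
  · exact ⟨i, hy, by rw [← hi']; simp [hy]⟩
  · rw [← hi'] at h; simp [hy] at h

theorem IsUniversalPrefixMachine.condKFun_ne_top {U : List Bool → List Bool →. List Bool}
    (hU : IsUniversalPrefixMachine U) {f : List Bool → ℝ} (hf : IsEnumerable f) (x : List Bool) :
    condKFun U f x ≠ ⊤ := by
  obtain ⟨i, hi⟩ := hf.exists_index
  exact ne_top_of_le_ne_top (hU.condK_ne_top (natStr i) x) (iInf₂_le i hi)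

theorem exists_program {U : List Bool → List Bool →. List Bool} (hU : IsUniversalPrefixMachine U)
    {f : List Bool → ℝ} (hf : IsEnumerable f) :
    ∃ p i, natStr i ∈ U p [] ∧ IsIndex i f ∧ funWeight U f = 2⁻¹ ^ p.length := by
  obtain ⟨i, hi, hi'⟩ := exists_of_condKFun_ne_top (hU.condKFun_ne_top hf [])
  obtain ⟨p, hp, hp'⟩ := exists_of_condK_ne_top (hU.condK_ne_top (natStr i) [])
  refine ⟨p, i, hp, hi, ?_⟩
  have : condKFun U f [] = (p.length : ℕ∞) := by rw [← hi', hp', condKNat]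
  rw [funWeight, this, ENat.toNat_natCast]

theorem IsSemimeasure.le_one {ρ : List Bool → ℝ} (h : IsSemimeasure ρ) (x : List Bool) :
    ρ x ≤ 1 := by
  induction x using List.reverseRecOn with
  | nil => exact h.nil_le
  | append_singleton x b ih =>
    have h1 := h.add_le x
    have h2 := h.nonneg (x ++ [false])
    have h3 := h.nonneg (x ++ [true])
    cases b <;> linarith

/-- Nonnegative functions with the same rationals strictly below each value agree. -/
theorem IsIndex.eq_of_semimeasure {i : ℕ} {f g : List Bool → ℝ} (hf : IsIndex i f)
    (hg : IsIndex i g) (hf0 : IsSemimeasure f) (hg0 : IsSemimeasure g) : f = g := by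
  have key : ∀ {f g : List Bool → ℝ}, IsIndex i f → IsIndex i g → IsSemimeasure f →
      IsSemimeasure g → ∀ x, f x ≤ g x := by
    intro f g hf hg hf0 hg0 x
    by_contra! hlt
    obtain ⟨q, hq1, hq2⟩ := exists_rat_btwn hlt
    have hq0 : 0 ≤ q := by exact_mod_cast ((hg0.nonneg x).trans_lt hq1).le
    have hq : ((q.num.toNat : ℕ) : ℝ) / ((q.den - 1 : ℕ) + 1) = q := by
      have h1 : ((q.num.toNat : ℕ) : ℝ) = (q.num : ℝ) := by
        exact_mod_cast Int.toNat_of_nonneg (Rat.num_nonneg.2 hq0)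
      have h2 : ((q.den - 1 : ℕ) : ℝ) + 1 = q.den := by
        exact_mod_cast Nat.sub_add_cancel q.pos
      rw [h1, h2]
      exact_mod_cast Rat.num_div_den q
    have h1 := (hf (x, q.num.toNat, q.den - 1)).2 (by simp only; rw [hq]; exact hq2)
    have h2 := (hg _).1 h1
    simp only at h2
    rw [hq] at h2
    linarith
  exact funext fun x => le_antisymm (key hf hg hf0 hg0 x) (key hg hf hg0 hf0 x)

/-- A shortest program for an index of an enumerable semimeasure. -/
theorem exists_injective_program {U : List Bool → List Bool →. List Bool}
    (hU : IsUniversalPrefixMachine U) :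
    ∃ P : EnumSemimeasure → List Bool, Function.Injective P ∧ ∀ ν,
      (∃ i, natStr i ∈ U (P ν) [] ∧ IsIndex i ν.1) ∧ funWeight U ν.1 = 2⁻¹ ^ (P ν).length := by
  choose P I h1 h2 h3 using fun ν : EnumSemimeasure => exists_program hU ν.2.2
  refine ⟨P, fun ν ρ h => ?_, fun ν => ⟨⟨I ν, h1 ν, h2 ν⟩, h3 ν⟩⟩
  have hs : natStr (I ν) = natStr (I ρ) := Part.mem_unique (h1 ν) (h ▸ h1 ρ)
  have hi : I ν = I ρ := by rw [← strNat_natStr (I ν), hs, strNat_natStr]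
  exact Subtype.ext ((h2 ν).eq_of_semimeasure (hi ▸ h2 ρ) ν.2.1 ρ.2.1)

theorem ePrior_le_one {U : List Bool → List Bool →. List Bool} (hU : IsUniversalPrefixMachine U)
    (x : List Bool) : ePrior U x ≤ 1 := by
  classical
  obtain ⟨P, hinj, hP⟩ := exists_injective_program hU
  refine le_trans ?_ (hU.isPrefixMachine.kraft [])
  refine le_trans (ENNReal.tsum_le_tsum fun ν => ?_) (ENNReal.tsum_comp_le_tsum_of_injective hinj _)
  obtain ⟨⟨i, hi, -⟩, hw⟩ := hP ν
  rw [if_pos (Part.dom_iff_mem.2 ⟨_, hi⟩), hw]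
  exact mul_le_of_le_one_right' (ENNReal.ofReal_le_one.2 (ν.2.1.le_one x))

theorem prior_eq_toReal {U : List Bool → List Bool →. List Bool} (hU : IsUniversalPrefixMachine U)
    (x : List Bool) : prior U x = (ePrior U x).toReal := by
  rw [ePrior, ENNReal.tsum_toReal_eq fun ν => ENNReal.mul_ne_top
    (by simp [funWeight]) ENNReal.ofReal_ne_top]
  refine tsum_congr fun ν => ?_
  rw [ENNReal.toReal_mul, ENNReal.toReal_ofReal (ν.2.1.nonneg x), twoPowNeg,
    if_neg (hU.condKFun_ne_top ν.2.2 []), funWeight, ENNReal.toReal_pow, ENNReal.toReal_inv]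
  rfl

/-! ### The universal prior of the strings `0ˡ1` -/

/-- The string `0ˡ1`. -/
def zerosOne (l : ℕ) : List Bool := List.replicate l false ++ [true]

theorem computable_replicate : Computable fun l : ℕ => List.replicate l false := by
  have h : Primrec fun l : ℕ => (List.range l).map fun _ => false :=
    Primrec.list_map Primrec.list_range (Primrec₂.const false)
  refine h.to_comp.of_eq fun l => ?_
  simp [List.map_const']

/-- The program `p` computes an index of a function that is certified to exceed `2 ^ (-j)` at the
string `0ˡ1`. -/
def Certified (U : List Bool → List Bool →. List Bool) (a : List Bool × ℕ × ℕ) : Prop :=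
  ∃ s ∈ U a.1 [], ((Denumerable.ofNat Nat.Partrec.Code (strNat s)).eval
    (Encodable.encode ((zerosOne a.2.1, 1, 2 ^ a.2.2 - 1) : List Bool × ℕ × ℕ))).Dom

theorem rePred_certified {U : List Bool → List Bool →. List Bool} (hU : Partrec₂ U) :
    REPred (Certified U) := by
  have h1 : Partrec fun a : List Bool × ℕ × ℕ => U a.1 [] :=
    hU.comp Computable.fst (Computable.const [])
  have hz : Computable zerosOne := Computable.list_append.comp computable_replicate
    (Computable.const [true])
  have h2 : Partrec₂ fun (a : List Bool × ℕ × ℕ) (s : List Bool) =>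
      (Denumerable.ofNat Nat.Partrec.Code (strNat s)).eval
        (Encodable.encode ((zerosOne a.2.1, 1, 2 ^ a.2.2 - 1) : List Bool × ℕ × ℕ)) := by
    refine Nat.Partrec.Code.eval_part.comp
      ((Computable.ofNat _).comp (computable_strNat.comp Computable.snd)) ?_
    have hl : Computable fun b : (List Bool × ℕ × ℕ) × List Bool => b.1.2.1 :=
      Computable.fst.comp (Computable.snd.comp Computable.fst)
    have hj : Computable fun b : (List Bool × ℕ × ℕ) × List Bool => b.1.2.2 :=
      Computable.snd.comp (Computable.snd.comp Computable.fst)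
    exact Computable.encode.comp ((hz.comp hl).pair ((Computable.const 1).pair
      (Primrec.nat_sub.to_comp.comp (computable_pow_two.comp hj) (Computable.const 1))))
  refine (h1.bind h2).dom_re.of_eq fun a => ?_
  rw [Part.bind_dom]
  constructor
  · rintro ⟨h, h'⟩
    exact ⟨_, Part.get_mem h, h'⟩
  · rintro ⟨s, hs, h'⟩
    refine ⟨Part.dom_iff_mem.2 ⟨s, hs⟩, ?_⟩
    rwa [Part.get_eq_of_mem hs]

theorem certified_iff {U : List Bool → List Bool →. List Bool} {p : List Bool} {i : ℕ}
    {ν : List Bool → ℝ} (hp : natStr i ∈ U p []) (hi : IsIndex i ν) (l j : ℕ) :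
    Certified U (p, l, j) ↔ 2⁻¹ ^ j < ENNReal.ofReal (ν (zerosOne l)) := by
  have h1 : Certified U (p, l, j) ↔ ((Denumerable.ofNat Nat.Partrec.Code i).eval
      (Encodable.encode ((zerosOne l, 1, 2 ^ j - 1) : List Bool × ℕ × ℕ))).Dom := by
    constructor
    · rintro ⟨s, hs, h⟩
      rw [Part.mem_unique hs hp, strNat_natStr] at h
      exact h
    · intro h
      exact ⟨_, hp, by rw [strNat_natStr]; exact h⟩
  rw [h1, hi]
  -- Rationals are coded as k/(n + 1), so 2^(-j) is the pair (1, 2^j - 1).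
  have h2 : ((2 ^ j - 1 : ℕ) : ℝ) + 1 = 2 ^ j := by
    exact_mod_cast Nat.sub_add_cancel (Nat.one_le_two_pow (n := j))
  have h3 : (2⁻¹ : ℝ≥0∞) ^ j = ENNReal.ofReal (1 / 2 ^ j) := by
    rw [one_div, ← inv_pow, ENNReal.ofReal_pow (by norm_num),
      ENNReal.ofReal_inv_of_pos (by norm_num)]
    simp
  simp only [h2, Nat.cast_one]
  rw [h3, ENNReal.ofReal_lt_ofReal_iff_of_nonneg (by positivity)]

/-- At each step the mass of 0ᴺ splits into that of 0ᴺ1 and what remains at 0ᴺ⁺¹. -/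
theorem IsSemimeasure.tsum_zerosOne_le {ρ : List Bool → ℝ} (h : IsSemimeasure ρ) :
    ∑' l, ENNReal.ofReal (ρ (zerosOne l)) ≤ 1 := by
  have h1 : ∀ N, ∑ l ∈ Finset.range N, ρ (zerosOne l) + ρ (List.replicate N false) ≤ 1 := by
    intro N
    induction N with
    | zero => simpa using h.nil_le
    | succ N ih =>
      have := h.add_le (List.replicate N false)
      rw [Finset.sum_range_succ, List.replicate_succ']
      unfold zerosOne at ih ⊢
      linarith
  refine ENNReal.tsum_le_of_sum_range_le fun N => ?_
  rw [← ENNReal.ofReal_sum_of_nonneg fun _ _ => h.nonneg _]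
  have := h.nonneg (List.replicate N false)
  exact ENNReal.ofReal_le_one.2 (by linarith [h1 N])

/-- The prefix sums increase, so the retained nonzero terms come from an initial segment whose sum
is within B. -/
theorem tsum_truncated_le (x : ℕ → ℝ≥0∞) (B : ℝ≥0∞) :
    ∑' n, (if ∑ i ∈ Finset.range (n + 1), x i ≤ B then x n else 0) ≤ B := by
  classical
  have h : ∀ N, ∑ n ∈ Finset.range N, (if ∑ i ∈ Finset.range (n + 1), x i ≤ B then x n else 0) ≤
      min B (∑ n ∈ Finset.range N, x n) := by
    intro N
    induction N with
    | zero => simp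
    | succ N ih =>
      rw [Finset.sum_range_succ]
      have h2 := ih.trans (min_le_right _ _)
      split_ifs with hB
      · rw [min_eq_right hB, Finset.sum_range_succ x]
        gcongr
      · rw [add_zero]
        refine ih.trans (min_le_min_left _ ?_)
        rw [Finset.sum_range_succ]
        exact le_self_add
  exact ENNReal.tsum_le_of_sum_range_le fun N => (h N).trans (min_le_left _ _)

/-- The exponents `j` of the events `(p, l, j)` of `g` with the given `p`. -/
def eventsOf (g : ℕ → Option (List Bool × ℕ × ℕ)) (p : List Bool) (n : ℕ) : Option ℕ :=
  (g n).bind fun a => bif decide (a.1 = p) then some a.2.2 else none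

theorem weight_eventsOf (g : ℕ → Option (List Bool × ℕ × ℕ)) (p : List Bool) (n : ℕ) :
    weight (eventsOf g p n) = (g n).elim 0 fun a => if a.1 = p then 2⁻¹ ^ a.2.2 else 0 := by
  cases h : g n with
  | none => simp [eventsOf, weight, h]
  | some a =>
    by_cases hl : a.1 = p
    · simp [eventsOf, weight, h, hl]
    · simp [eventsOf, weight, h, hl]

/-- The stream `(l, ℓ(p) + j + 1)` of those events `(p, l, j)` of `g` for which the total weight of
the events of `p` up to that moment is at most `2`. -/
def budgeted (g : ℕ → Option (List Bool × ℕ × ℕ)) (n : ℕ) : Option (ℕ × ℕ) :=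
  (g n).bind fun a => bif decide (dyadicSum (eventsOf g a.1) (n + 1) ≤ 2 * 2 ^ (n + 1))
    then some (a.2.1, a.1.length + a.2.2 + 1) else none

theorem computable_budgeted {g : ℕ → Option (List Bool × ℕ × ℕ)} (hg : Computable g) :
    Computable (budgeted g) := by
  have hev : Computable₂ (eventsOf g) := by
    refine Computable.option_bind (hg.comp Computable.snd) ?_
    have heq : Computable₂ fun p q : List Bool => decide (p = q) :=
      (PrimrecPred.decide Primrec.eq).to_comp
    exact Computable.cond (heq.comp (Computable.fst.comp Computable.snd)
      (Computable.fst.comp Computable.fst))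
      (Computable.option_some.comp (Computable.snd.comp (Computable.snd.comp Computable.snd)))
      (Computable.const none)
  have hD := computable_dyadicSum hev
  unfold budgeted
  generalize hE : (fun p N => dyadicSum (eventsOf g p) N) = E at hD
  have hE' : ∀ p N, dyadicSum (eventsOf g p) N = E p N := fun p N => by rw [← hE]
  simp only [hE']
  refine Computable.option_bind hg ?_
  have hle : Computable₂ fun a b : ℕ => decide (a ≤ b) :=
    (PrimrecPred.decide Primrec.nat_le).to_comp
  have hp : Computable fun b : ℕ × (List Bool × ℕ × ℕ) => b.2.1 :=
    Computable.fst.comp Computable.snd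
  have hn : Computable fun b : ℕ × (List Bool × ℕ × ℕ) => b.1 + 1 :=
    Computable.succ.comp Computable.fst
  have hl : Computable fun b : ℕ × (List Bool × ℕ × ℕ) => b.2.2.1 :=
    Computable.fst.comp (Computable.snd.comp Computable.snd)
  have hj : Computable fun b : ℕ × (List Bool × ℕ × ℕ) => b.2.2.2 :=
    Computable.snd.comp (Computable.snd.comp Computable.snd)
  have h1 := hle.comp (hD.comp hp hn)
    (Primrec.nat_mul.to_comp.comp (Computable.const 2) (computable_pow_two.comp hn))
  exact Computable.cond h1 (Computable.option_some.comp (hl.pair (Computable.succ.comp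
    (Primrec.nat_add.to_comp.comp (Computable.list_length.comp hp) hj)))) (Computable.const none)

/-- The event stream `g` stays within budget for the program `p` up to time `n`. -/
def WithinBudget (g : ℕ → Option (List Bool × ℕ × ℕ)) (p : List Bool) (n : ℕ) : Prop :=
  ∑ i ∈ Finset.range (n + 1), weight (eventsOf g p i) ≤ 2

theorem dyadicSum_eventsOf_le_iff {g : ℕ → Option (List Bool × ℕ × ℕ)}
    (hle : ∀ n a, g n = some a → a.1.length + a.2.2 + 1 ≤ n) (p : List Bool) (n : ℕ) :
    dyadicSum (eventsOf g p) (n + 1) ≤ 2 * 2 ^ (n + 1) ↔ WithinBudget g p n := by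
  have hev : ∀ n d, eventsOf g p n = some d → d ≤ n := by
    intro n d h
    simp only [eventsOf, Option.bind_eq_some_iff] at h
    obtain ⟨a, ha, h⟩ := h
    have := hle n a ha
    cases hc : decide (a.1 = p) with
    | false => simp [hc] at h
    | true => simp [hc] at h; omega
  unfold WithinBudget
  constructor
  · intro h; exact_mod_cast sum_weight_le hev h
  · intro h; exact dyadicSum_le hev (by exact_mod_cast h)

theorem budgeted_eq {g : ℕ → Option (List Bool × ℕ × ℕ)}
    (hle : ∀ n a, g n = some a → a.1.length + a.2.2 + 1 ≤ n) {n : ℕ} {a : List Bool × ℕ × ℕ}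
    (ha : g n = some a) [Decidable (WithinBudget g a.1 n)] :
    budgeted g n = if WithinBudget g a.1 n then some (a.2.1, a.1.length + a.2.2 + 1) else none := by
  simp only [budgeted, ha, Option.bind_some, dyadicSum_eventsOf_le_iff hle, Bool.cond_decide]

/-- Within its budget 2, a halting program p contributes at most 2^(-ℓ(p)-1)·2 = 2^(-ℓ(p)), and
Kraft's inequality applies whether or not p describes a semimeasure. -/
theorem tsum_weight_budgeted {U : List Bool → List Bool →. List Bool}
    (hU : IsUniversalPrefixMachine U) {g : ℕ → Option (List Bool × ℕ × ℕ)}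
    (hle : ∀ n a, g n = some a → a.1.length + a.2.2 + 1 ≤ n)
    (hg : ∀ n a, g n = some a → Certified U a) :
    ∑' n, weight ((budgeted g n).map Prod.snd) ≤ 1 := by
  classical
  have h1 : ∀ n, weight ((budgeted g n).map Prod.snd) =
      ∑' p, (if (U p []).Dom then (2⁻¹ : ℝ≥0∞) ^ (p.length + 1) else 0) *
        if WithinBudget g p n then weight (eventsOf g p n) else 0 := by
    intro n
    simp only [weight_eventsOf]
    cases ha : g n with
    | none => simp [budgeted, ha, weight]
    | some a =>
      rw [tsum_eq_single a.1 (fun p hp => by simp [Ne.symm hp]), budgeted_eq hle ha]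
      obtain ⟨s, hs, -⟩ := hg n a ha
      rw [if_pos (Part.dom_iff_mem.2 ⟨s, hs⟩)]
      split_ifs
      · simp [weight, pow_add]; ring
      · simp [weight]
  simp_rw [h1]
  rw [ENNReal.tsum_comm]
  refine le_trans (ENNReal.tsum_le_tsum fun p => ?_) (hU.isPrefixMachine.kraft [])
  rw [ENNReal.tsum_mul_left]
  have h2 : ∑' n, (if WithinBudget g p n then weight (eventsOf g p n) else 0) ≤ 2 := by
    convert tsum_truncated_le (fun n => weight (eventsOf g p n)) 2
    exact Iff.rfl
  refine (mul_le_mul_right h2 _).trans ?_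
  split_ifs
  · rw [pow_succ, mul_assoc, ENNReal.inv_mul_cancel (by simp) (by simp), mul_one]
  · simp

theorem le_tsum_weight_budgeted {U : List Bool → List Bool →. List Bool}
    (hU : IsUniversalPrefixMachine U) {g : ℕ → Option (List Bool × ℕ × ℕ)}
    (hle : ∀ n a, g n = some a → a.1.length + a.2.2 + 1 ≤ n)
    (hg : ∀ n a, g n = some a → Certified U a)
    (hg' : ∀ a, Certified U a → ∃! n, g n = some a) (l : ℕ) :
    ePrior U (zerosOne l) ≤ 4 * ∑' n, weight (restrict (budgeted g) l n) := by
  classical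
  obtain ⟨P, hinj, hP⟩ := exists_injective_program hU
  let G : List Bool → ℝ≥0∞ := fun p => ∑' n, if WithinBudget g p n then
    (g n).elim 0 (fun a => if a.1 = p ∧ a.2.1 = l then 2⁻¹ ^ (a.1.length + a.2.2 + 1) else 0) else 0
  have hG : ∑' p, G p = ∑' n, weight (restrict (budgeted g) l n) := by
    rw [ENNReal.tsum_comm]
    refine tsum_congr fun n => ?_
    rw [weight_restrict]
    cases ha : g n with
    | none => simp [budgeted, ha]
    | some a =>
      rw [tsum_eq_single a.1 (fun p hp => by simp [Ne.symm hp]), budgeted_eq hle ha]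
      by_cases hb : WithinBudget g a.1 n <;> simp [hb]
  rw [← hG]
  refine le_trans ?_ (mul_le_mul_right (ENNReal.tsum_comp_le_tsum_of_injective hinj G) 4)
  rw [← ENNReal.tsum_mul_left]
  refine ENNReal.tsum_le_tsum fun ν => ?_
  obtain ⟨⟨i, hp, hi⟩, hw⟩ := hP ν
  set p := P ν
  have hcert := certified_iff hp hi
  -- A program for a semimeasure is never cut off: its events at 0ᵏ1 weigh at most 2ν(0ᵏ1), and
  -- these values sum to at most 2.
  have hbud : ∀ n, WithinBudget g p n := by
    intro n
    refine (ENNReal.sum_le_tsum _).trans ?_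
    simp_rw [weight_eventsOf]
    rw [tsum_enumeration hg hg', ENNReal.tsum_prod',
      tsum_eq_single p (fun q hq => by simp [hq]), ENNReal.tsum_prod']
    calc _ ≤ ∑' k, 2 * ENNReal.ofReal (ν.1 (zerosOne k)) := by
            refine ENNReal.tsum_le_tsum fun k => ?_
            simp only [if_true]
            exact tsum_pow_le _ _ fun j hj => ((hcert k j).1 hj).le
      _ ≤ 2 * 1 := by
            rw [ENNReal.tsum_mul_left]
            exact mul_le_mul_right ν.2.1.tsum_zerosOne_le 2
      _ = 2 := mul_one 2
  rcases eq_or_ne (ENNReal.ofReal (ν.1 (zerosOne l))) 0 with h0 | h0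
  · rw [h0, mul_zero]; exact zero_le
  -- A single event with 2^(-j) within a factor 2 of ν(0ˡ1) suffices; the other factor 2 comes from
  -- the + 1 in the exponent.
  obtain ⟨j, hj, hj'⟩ := exists_pow_lt h0 (ENNReal.ofReal_le_one.2 (ν.2.1.le_one _))
  obtain ⟨n, hn, -⟩ := hg' _ ((hcert l j).2 hj)
  have hGp : (2⁻¹ : ℝ≥0∞) ^ (p.length + j + 1) ≤ G p := by
    refine le_trans ?_ (ENNReal.le_tsum n)
    simp [hbud, hn]
  calc funWeight U ν.1 * ENNReal.ofReal (ν.1 (zerosOne l))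
      ≤ 2⁻¹ ^ p.length * (2 * 2⁻¹ ^ j) := by rw [hw]; gcongr
    _ = 2⁻¹ ^ p.length * (2 * 2⁻¹ ^ j) * (2 ^ 1 * 2⁻¹ ^ 1) := by rw [two_inv_pow_mul, mul_one]
    _ = 4 * 2⁻¹ ^ (p.length + j + 1) := by ring
    _ ≤ _ := by gcongr

theorem ePrior_zerosOne_le {U : List Bool → List Bool →. List Bool}
    (hU : IsUniversalPrefixMachine U) :
    ∃ c : ℕ, ∀ l, ePrior U (zerosOne l) ≤ 2 ^ c * 2⁻¹ ^ (KNat U l).toNat := by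
  obtain ⟨g, hgc, hle, hg, hg'⟩ := exists_enumeration (rePred_certified hU.isPrefixMachine.partrec)
    (d := fun a => a.1.length + a.2.2 + 1) (Computable.succ.comp (Primrec.nat_add.to_comp.comp
      (Computable.list_length.comp Computable.fst) (Computable.snd.comp Computable.snd)))
  obtain ⟨c, hc⟩ := coding_theorem hU (computable_budgeted hgc) (by
    classical
    intro n b h
    cases ha : g n with
    | none => simp [budgeted, ha] at h
    | some a =>
      rw [budgeted_eq hle ha] at h
      split_ifs at h
      cases h
      exact hle n a ha) (tsum_weight_budgeted hU hle hg)
  refine ⟨c + 2, fun l => (le_tsum_weight_budgeted hU hle hg hg' l).trans ?_⟩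
  refine (mul_le_mul_right (hc l) 4).trans (le_of_eq ?_)
  ring

/-! ### Point masses -/

/-- The deterministic measure concentrated on the sequence `α`. -/
noncomputable def pointMass (α : ℕ → Bool) (x : List Bool) : ℝ :=
  if x = (List.range x.length).map α then 1 else 0

theorem pointMass_concat (α : ℕ → Bool) (x : List Bool) (b : Bool) :
    pointMass α (x ++ [b]) = if b = α x.length then pointMass α x else 0 := by
  have h : x ++ [b] = (List.range (x ++ [b]).length).map α ↔
      x = (List.range x.length).map α ∧ b = α x.length := by
    rw [List.length_append, List.length_singleton, List.range_succ, List.map_append]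
    constructor
    · intro h
      obtain ⟨h1, h2⟩ := List.append_inj' h rfl
      exact ⟨h1, by simpa using h2⟩
    · rintro ⟨h1, h2⟩
      rw [← h1, List.map_singleton, ← h2]
  unfold pointMass
  simp only [h]
  by_cases h2 : b = α x.length <;> simp [h2]

theorem isMeasure_pointMass (α : ℕ → Bool) : IsMeasure (pointMass α) where
  nonneg x := by unfold pointMass; split_ifs <;> norm_num
  nil_eq := by simp [pointMass]
  add_eq x := by
    rw [pointMass_concat, pointMass_concat]
    cases α x.length <;> simp

theorem isDeterministic_pointMass (α : ℕ → Bool) : IsDeterministic (pointMass α) := by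
  refine ⟨α, fun n => if_pos ?_⟩
  refine List.ext_getElem (by simp) fun i h1 h2 => by simp

theorem IsMeasure.isSemimeasure {ρ : List Bool → ℝ} (h : IsMeasure ρ) : IsSemimeasure ρ :=
  ⟨h.nonneg, h.nil_eq.le, fun x => (h.add_eq x).le⟩

theorem primrecPred_onPath {α : ℕ → ℕ → Bool} (hα : Primrec₂ α) :
    PrimrecPred fun a : ℕ × List Bool => a.2 = (List.range a.2.length).map (α a.1) := by
  refine Primrec.eq.comp Primrec.snd (Primrec.list_map
    (Primrec.list_range.comp (Primrec.list_length.comp Primrec.snd)) ?_)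
  exact hα.comp (Primrec.fst.comp Primrec.fst) Primrec.snd

theorem lt_pointMass_iff (α : ℕ → Bool) (x : List Bool) (k n : ℕ) :
    (k : ℝ) / (n + 1) < pointMass α x ↔ x = (List.range x.length).map α ∧ k < n + 1 := by
  unfold pointMass
  split_ifs with h
  · rw [div_lt_one (by positivity)]
    simp only [← h, true_and]
    exact_mod_cast Iff.rfl
  · simp only [h, false_and, iff_false, not_lt]
    positivity

theorem pointMass_lt_iff (α : ℕ → Bool) (x : List Bool) (k n : ℕ) :
    pointMass α x < (k : ℝ) / (n + 1) ↔
      (x = (List.range x.length).map α ∧ n + 1 < k) ∨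
        (¬ x = (List.range x.length).map α ∧ 0 < k) := by
  unfold pointMass
  split_ifs with h
  · rw [one_lt_div (by positivity)]
    simp only [← h, true_and, not_true_eq_false, false_and, or_false]
    exact_mod_cast Iff.rfl
  · simp only [h, false_and, false_or, not_false_eq_true, true_and]
    rw [lt_div_iff₀ (by positivity), zero_mul, Nat.cast_pos]

theorem primrecPred_lt_pointMass {α : ℕ → ℕ → Bool} (hα : Primrec₂ α) :
    PrimrecPred fun a : ℕ × (List Bool × ℕ × ℕ) =>
      (a.2.2.1 : ℝ) / (a.2.2.2 + 1) < pointMass (α a.1) a.2.1 := by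
  simp_rw [lt_pointMass_iff]
  exact PrimrecPred.and ((primrecPred_onPath hα).comp (Primrec.fst.pair
    (Primrec.fst.comp Primrec.snd))) (Primrec.nat_lt.comp
    (Primrec.fst.comp (Primrec.snd.comp Primrec.snd))
    (Primrec.succ.comp (Primrec.snd.comp (Primrec.snd.comp Primrec.snd))))

theorem isComputableMeasure_pointMass {α : ℕ → Bool} (hα : Primrec α) :
    IsComputableMeasure (pointMass α) := by
  have hα' : Primrec₂ fun _ : ℕ => α := hα.comp Primrec.snd
  have hon := primrecPred_onPath hα'
  refine ⟨isMeasure_pointMass α, ?_, ?_, ?_⟩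
  · exact ((primrecPred_lt_pointMass hα').comp
      ((Primrec.const 0).pair Primrec.id)).computablePred.to_re
  · have h1 := hon.comp (f := fun a : List Bool × ℕ × ℕ => ((0 : ℕ), a.1))
      ((Primrec.const 0).pair Primrec.fst)
    have hk : Primrec fun a : List Bool × ℕ × ℕ => a.2.1 := Primrec.fst.comp Primrec.snd
    have hn : Primrec fun a : List Bool × ℕ × ℕ => a.2.2 + 1 :=
      Primrec.succ.comp (Primrec.snd.comp Primrec.snd)
    have h2 := (h1.and (Primrec.nat_lt.comp hn hk)).or
      (h1.not.and (Primrec.nat_lt.comp (Primrec.const 0) hk))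
    exact h2.computablePred.to_re.of_eq fun a => (pointMass_lt_iff α a.1 a.2.1 a.2.2).symm
  · refine ((hon.comp (f := fun x : List Bool => ((0 : ℕ), x))
      ((Primrec.const 0).pair Primrec.id)).not).computablePred.of_eq fun x => ?_
    unfold pointMass
    split_ifs with h
    · simp [← h]
    · simp [h]

/-- The s-m-n theorem: the parameter l is curried into a code deciding the family uniformly. -/
theorem exists_computable_index {α : ℕ → ℕ → Bool} (hα : Primrec₂ α) :
    ∃ I : ℕ → ℕ, Computable I ∧ ∀ l, IsIndex (I l) (pointMass (α l)) := by
  obtain ⟨c, hc⟩ := Nat.Partrec.Code.exists_code.1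
    (primrecPred_lt_pointMass hα).computablePred.to_re
  refine ⟨fun l => Encodable.encode (Nat.Partrec.Code.curry c l), ?_, fun l a => ?_⟩
  · exact Computable.encode.comp (Nat.Partrec.Code.primrec₂_curry.to_comp.comp
      (Computable.const c) Computable.id)
  · rw [Denumerable.ofNat_encode, Nat.Partrec.Code.eval_curry, hc]
    have : Nat.pair l (Encodable.encode a) = Encodable.encode (l, a) := rfl
    rw [this]
    beta_reduce
    rw [Encodable.encodek]
    simp [Part.assert]

/-! ### Complexity bounds -/

/-- A machine that halts only on the empty program can output an index computed from the length of
the condition, at cost 0. -/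
theorem exists_condKFun_le {U : List Bool → List Bool →. List Bool}
    (hU : IsUniversalPrefixMachine U) {α : ℕ → ℕ → Bool} (hα : Primrec₂ α) :
    ∃ c : ℕ, ∀ x, condKFun U (pointMass (α x.length)) x ≤ c := by
  obtain ⟨I, hI, hI'⟩ := exists_computable_index hα
  let T : List Bool → List Bool →. List Bool := fun p x =>
    bif p.isEmpty then Part.some (natStr (I x.length)) else Part.none
  have hdom : ∀ p x, (T p x).Dom → p = [] := by
    intro p x h
    cases p with
    | nil => rfl
    | cons a p => simp [T] at h
  have hT : IsPrefixMachine T := by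
    refine ⟨?_, fun x p q hp hq _ => by rw [hdom p x hp, hdom q x hq]⟩
    have hc : Computable (fun a : List Bool × List Bool => a.1.isEmpty) := by
      have h : Computable (fun a : List Bool × List Bool => a.1.length == 0) :=
        (Primrec.beq.comp (Primrec.list_length.comp Primrec.fst) (Primrec.const 0)).to_comp
      refine h.of_eq fun a => ?_
      cases a.1 <;> simp
    have hs : Computable fun a : List Bool × List Bool => natStr (I a.2.length) :=
      computable_natStr.comp (hI.comp (Computable.list_length.comp Computable.snd))
    exact Partrec.cond hc hs.partrec Partrec.none
  obtain ⟨c, hc⟩ := hU.optimal T hT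
  refine ⟨c, fun x => ?_⟩
  refine (iInf₂_le (I x.length) (hI' x.length)).trans ((hc _ x).trans ?_)
  have h1 : condK T (natStr (I x.length)) x ≤ 0 :=
    iInf₂_le_of_le [] (show natStr (I x.length) ∈ T [] x by simp [T]) (by simp)
  simpa using add_le_add_left h1 (c : ℕ∞)

theorem funWeight_le_ePrior (U : List Bool → List Bool →. List Bool) {ν : List Bool → ℝ}
    (hν : IsSemimeasure ν) (hν' : IsEnumerable ν) {x : List Bool} (hx : ν x = 1) :
    funWeight U ν ≤ ePrior U x := by
  refine le_trans ?_ (ENNReal.le_tsum (⟨ν, hν, hν'⟩ : EnumSemimeasure))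
  simp [hx]

theorem divergence_one (U : List Bool → List Bool →. List Bool) (μ : List Bool → ℝ)
    (x : List Bool) : divergence U μ x 1 = ∑ b : Bool, condProb μ [b] x *
      Real.log (condProb μ [b] x / condProb (prior U) [b] x) := by
  refine Fintype.sum_equiv (Equiv.funUnique (Fin 1) Bool) _ _ fun y => ?_
  simp

end AlgPred

/-! ### The measure concentrated on 0ˡ1^∞ and the final estimate -/

open AlgPred in
theorem lemma6 (U : List Bool → List Bool →. List Bool)
    (hU : AlgPred.IsUniversalPrefixMachine U) :
    ∃ (C₀ : ℕ) (C₁ : ℝ), ∀ l : ℕ, ∃ (μ : List Bool → ℝ) (x : List Bool),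
      AlgPred.IsComputableMeasure μ ∧ AlgPred.IsDeterministic μ ∧ x.length = l ∧ 0 < μ x ∧
      AlgPred.condKFun U μ x ≤ (C₀ : ℕ∞) ∧
      |AlgPred.deficiency U μ x| ≤ (C₀ : ℝ) ∧
      AlgPred.divergence U μ x 1 =
        ∑ b : Bool, AlgPred.condProb μ [b] x *
          Real.log (AlgPred.condProb μ [b] x / AlgPred.condProb (AlgPred.prior U) [b] x) ∧
      ((AlgPred.KNat U l).toNat : ℝ) * Real.log 2 - C₁ ≤ AlgPred.divergence U μ x 1 := by
  have hα : Primrec₂ fun l n : ℕ => decide (l ≤ n) := PrimrecPred.decide Primrec.nat_le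
  have hz : Primrec fun _ : ℕ => false := Primrec.const false
  obtain ⟨c₁, hc₁⟩ := exists_condKFun_le hU hα
  obtain ⟨c₂, hc₂⟩ := ePrior_zerosOne_le hU
  have hzero := isComputableMeasure_pointMass hz
  set k := (condKFun U (pointMass fun _ => false) []).toNat with hk
  -- Here c₁ bounds K(μ|x), k is the complexity of the point mass on 0^∞ and bounds the deficiency,
  -- and C₁ collects the losses in M(0ˡ) ≥ 2^(-k) and M(0ˡ1) ≤ 2^(c₂ - K(l)).
  refine ⟨max c₁ k, (k + c₂) * Real.log 2, fun l => ?_⟩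
  set μ := pointMass fun n => decide (l ≤ n) with hμ
  set x := List.replicate l false with hx
  have hxl : x.length = l := by simp [hx]
  have hμc : IsComputableMeasure μ :=
    isComputableMeasure_pointMass (hα.comp (Primrec.const l) Primrec.id)
  have hμx : μ x = 1 := by
    refine if_pos (List.ext_getElem (by simp) fun i h1 h2 => ?_)
    rw [hxl] at h1
    simp [hx, h1]
  have hμ1 : μ (x ++ [true]) = 1 := by
    rw [hμ, pointMass_concat, ← hμ, hμx, hxl]; simp
  have hμ0 : μ (x ++ [false]) = 0 := by
    rw [hμ, pointMass_concat, hxl]; simp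
  have hzx : pointMass (fun _ => false) x = 1 := by
    refine if_pos (List.ext_getElem (by simp) fun i h1 h2 => ?_)
    simp [hx]
  have hle1 := ePrior_le_one hU
  have hM : (2 : ℝ)⁻¹ ^ k ≤ prior U x := by
    have := funWeight_le_ePrior U hzero.isMeasure.isSemimeasure hzero.enumerable hzx
    have := ENNReal.toReal_mono (ne_top_of_le_ne_top (by simp) (hle1 x)) this
    rw [prior_eq_toReal hU]
    simpa [funWeight, ← hk] using this
  have hM0 : 0 < prior U x := lt_of_lt_of_le (by positivity) hM
  have hM1 : prior U x ≤ 1 := by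
    rw [prior_eq_toReal hU]
    exact ENNReal.toReal_le_of_le_ofReal (by simp) (by simpa using hle1 x)
  -- Positivity, ensured by the term of μ itself, is needed for the logarithms: `Real.log 0 = 0`
  -- would spoil the estimate.
  have hN0 : 0 < prior U (x ++ [true]) := by
    rw [prior_eq_toReal hU]
    refine ENNReal.toReal_pos ?_ (ne_top_of_le_ne_top (by simp) (hle1 _))
    have := funWeight_le_ePrior U hμc.isMeasure.isSemimeasure hμc.enumerable hμ1
    refine (lt_of_lt_of_le ?_ this).ne'
    simp [funWeight, pos_iff_ne_zero]
  have hN : prior U (x ++ [true]) ≤ 2 ^ c₂ * 2⁻¹ ^ (KNat U l).toNat := by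
    rw [prior_eq_toReal hU]
    have := ENNReal.toReal_mono (ENNReal.mul_ne_top (by simp) (by simp)) (hc₂ l)
    change (ePrior U (zerosOne l)).toReal ≤ _
    simpa using this
  have hlog2 : 0 < Real.log 2 := Real.log_pos (by norm_num)
  have hlogM : -(k * Real.log 2) ≤ Real.log (prior U x) := by
    have := Real.log_le_log (by positivity) hM
    simpa using this
  refine ⟨μ, x, hμc, isDeterministic_pointMass _, hxl, by simp [hμx], ?_, ?_,
    divergence_one U μ x, ?_⟩
  · refine le_trans ?_ (Nat.cast_le.2 (le_max_left c₁ k))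
    have := hc₁ x
    rwa [hxl] at this
  · rw [deficiency, hμx, div_one, Real.logb, abs_div, abs_of_pos hlog2, div_le_iff₀ hlog2,
      abs_of_nonpos (Real.log_nonpos hM0.le hM1)]
    have : (k : ℝ) ≤ (max c₁ k : ℕ) := Nat.cast_le.2 (le_max_right c₁ k)
    nlinarith
  · rw [divergence_one, Fintype.sum_bool]
    -- The term of the symbol 0 vanishes and the divergence becomes ln (M(x)/M(x1)).
    simp only [condProb, hμ1, hμ0, hμx, div_one, zero_div, zero_mul, add_zero, one_mul, one_div,
      inv_div]
    rw [Real.log_div hM0.ne' hN0.ne']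
    have := Real.log_le_log hN0 hN
    rw [Real.log_mul (by positivity) (by positivity), Real.log_pow, Real.log_pow,
      Real.log_inv] at this
    linarith
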